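/- A GF(2)-grammar over an alphabet $\Sigma$ is given by a set $N$ of nonterminal symbols, an initial symbol $S \in N$ and a finite set of rules $A \to X_1 \odot \cdots \odot X_\ell$ ($\ell \ge 0$, $A \in N$, $X_i \in \Sigma \cup N$), such that in the corresponding ordinary context-free grammar with rules $A \to X_1 \cdots X_\ell$ every word $w \in \Sigma^*$ has only finitely many parse trees. The language described by it is the set of all words $w \in \Sigma^*$ that have an odd number of parse trees (with root $S$) in the corresponding ordinary grammar. **Theorem.** Let $a, b, c$ be three distinct letters of an alphabet $\Sigma$. No GF(2)-grammar over $\Sigma$ describes the language $\{a^n b^n c^n \mid n \ge 0\}$. Moreover, let $R_{a,b,c}$ be the set of all elements of $\mathbb{F}_2((a,b,c))$, the field of fractions of $\mathbb{F}_2[[a,b,c]]$, that can be represented as $$\frac{\sum_{i=1}^n A_i B_i C_i}{p\,q\,r},$$ where $n \ge 0$; $A_i \in \mathbb{F}_2[[a]]$, $B_i \in \mathbb{F}_2[[b]]$, $C_i \in \mathbb{F}_2[[c]]$ are power series algebraic over $\mathbb{F}_2[a]$, $\mathbb{F}_2[b]$, $\mathbb{F}_2[c]$ respectively; and $p \in \mathbb{F}_2[a,b]$,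 $q \in \mathbb{F}_2[a,c]$, $r \in \mathbb{F}_2[b,c]$ are non-zero polynomials. Then $(1+abc)^{-1} \notin R_{a,b,c}$. -/

import Mathlib

/-! ### Parse trees and GF(2)-grammars -/

/-- `ParseForest g α` is the type of ordered sequences of parse trees of the ordinary
(context-free) grammar `g` whose roots, read from left to right, are labelled by the symbols of
`α`.  A tree whose root is a terminal is a single leaf.  A tree whose root is a nonterminal `A`
consists of a rule `A → β` of `g` and of a sequence of subtrees with roots `β`. -/
inductive ParseForest {T : Type*} (g : ContextFreeGrammar T) : List (Symbol T g.NT) → Type _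
  /-- The empty sequence of trees. -/
  | nil : ParseForest g []
  /-- A leaf labelled by the terminal `t`, followed by further trees. -/
  | leaf (t : T) {α : List (Symbol T g.NT)} (rest : ParseForest g α) :
      ParseForest g (Symbol.terminal t :: α)
  /-- A tree with root `A`, to which the rule `A → β` is applied, followed by further trees. -/
  | node (A : g.NT) (β : List (Symbol T g.NT)) (mem : ContextFreeRule.mk A β ∈ g.rules)
      (children : ParseForest g β) {α : List (Symbol T g.NT)} (rest : ParseForest g α) :
      ParseForest g (Symbol.nonterminal A :: α)

/-- The word that is spelled by the leaves of a sequence of parse trees, from left to right. -/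
def ParseForest.yield {T : Type*} {g : ContextFreeGrammar T} :
    {α : List (Symbol T g.NT)} → ParseForest g α → List T
  | _, .nil => []
  | _, .leaf t rest => t :: rest.yield
  | _, .node _ _ _ children rest => children.yield ++ rest.yield

/-- The set of parse trees of the word `w` in the ordinary grammar `g`, that is, of the trees with
yield `w` whose root is the initial symbol of `g`. -/
def ContextFreeGrammar.parseTrees {T : Type*} (g : ContextFreeGrammar T) (w : List T) :
    Set (ParseForest g [Symbol.nonterminal g.initial]) :=
  {t | t.yield = w}

/-- A GF(2)-grammar over the alphabet `T`: its nonterminals, its rules and its initial symbol are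
those of an ordinary grammar, in which every word has only finitely many parse trees. -/
structure GF2Grammar (T : Type*) where
  /-- The corresponding ordinary grammar. -/
  ordinary : ContextFreeGrammar T
  /-- Every word has a finite number of parse trees. -/
  finite_parseTrees : ∀ w : List T, (ordinary.parseTrees w).Finite

/-- The language described by a GF(2)-grammar: the set of all words with an odd number of parse
trees in the corresponding ordinary grammar. -/
def GF2Grammar.language {T : Type*} (G : GF2Grammar T) : Language T :=
  {w | Odd (G.ordinary.parseTrees w).ncard}

/-- The language `{aⁿ bⁿ cⁿ | n ≥ 0}`. -/
def languageANBNCN {T : Type*} (a b c : T) : Language T :=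
  {w | ∃ n : ℕ, w = List.replicate n a ++ List.replicate n b ++ List.replicate n c}

/-! ### The set `R_{a,b,c}` of Laurent series

The variables `a`, `b`, `c` are indexed by `0`, `1`, `2` in `Fin 3`.  Laurent series are fractions
of formal power series. -/

/-- The set of those power series in `F₂[[a, b, c]]` that are algebraic power series in the single
variable with index `i`: the images, under the substitution of that variable for `t`, of the
series in `F₂[[t]]` that are algebraic over `F₂[t]`. -/
def algebraicSeriesIn (i : Fin 3) : Set (MvPowerSeries (Fin 3) (ZMod 2)) :=
  {f | ∃ g : PowerSeries (ZMod 2), IsAlgebraic (Polynomial (ZMod 2)) g ∧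
    f = MvPowerSeries.rename (fun _ : Unit => i) g}

/-- The set of all Laurent series of the form `(∑ Aᵢ Bᵢ Cᵢ) / (p q r)`, where the sum is finite,
`Aᵢ`, `Bᵢ`, `Cᵢ` are algebraic power series in `a`, in `b` and in `c`, and `p`, `q`, `r` are
non-zero polynomials in `a, b`, in `a, c` and in `b, c`. -/
def Rabc : Set (FractionRing (MvPowerSeries (Fin 3) (ZMod 2))) :=
  {f | ∃ (n : ℕ) (A B C : Fin n → MvPowerSeries (Fin 3) (ZMod 2))
      (p q r : MvPolynomial (Fin 3) (ZMod 2)),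
    (∀ i, A i ∈ algebraicSeriesIn 0) ∧ (∀ i, B i ∈ algebraicSeriesIn 1) ∧
    (∀ i, C i ∈ algebraicSeriesIn 2) ∧
    p ∈ MvPolynomial.supported (ZMod 2) {0, 1} ∧ q ∈ MvPolynomial.supported (ZMod 2) {0, 2} ∧
    r ∈ MvPolynomial.supported (ZMod 2) {1, 2} ∧ p ≠ 0 ∧ q ≠ 0 ∧ r ≠ 0 ∧
    f = algebraMap (MvPowerSeries (Fin 3) (ZMod 2)) _ (∑ i, A i * B i * C i) /
      algebraMap (MvPowerSeries (Fin 3) (ZMod 2)) _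
        ((p * q * r : MvPolynomial (Fin 3) (ZMod 2)) : MvPowerSeries (Fin 3) (ZMod 2))}

/-!
Regard the numbers of parse trees as formal series in noncommuting letters. Substituting for the
letters `a`, `b`, `c` the transition matrices of an automaton that accepts only sorted words, each
multiplied by a commuting variable, turns the rules of the grammar into polynomial equations between
upper triangular matrices of power series. As the number of parse trees of each word is finite, the
linearisation of this system has an invertible constant term.

The diagonal entries involve one variable each, and they are algebraic by the Jacobian criterion.
Above the diagonal, the equations for the entries in the position `(s, t)` are linear modulo
products of entries that are nearer to the diagonal, with coefficients in the series in the
variables `s` and `t`. By Cramer's rule, the entries become sums of products of algebraic series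
in one variable each after multiplication by a determinant, which divides a nonzero polynomial in
two variables.

For the language `{aⁿ bⁿ cⁿ}`, the entry `(a, c)` is `1 / (1 - abc) - 1`. For no product `p` of
nonzero polynomials in two variables each is `p / (1 - abc)` a finite sum of products of a series
in `a` and `b` with a series in `c`, because its matrix of coefficients, with rows indexed by the
exponents of `a` and `b` and columns by that of `c`, contains triangular submatrices of every size
with a nonzero diagonal.
-/

/-! ### Algebraicity from a nonvanishing Jacobian determinant -/

section LinearAlgebra

theorem det_smul_mem_of_forall_sum_smul_mem {R M ι : Type*} [CommRing R] [AddCommGroup M]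
    [Module R M] [Fintype ι] [DecidableEq ι] (N : Submodule R M) {A : Matrix ι ι R} {v : ι → M}
    (h : ∀ i, ∑ j, A i j • v j ∈ N) (i : ι) : A.det • v i ∈ N := by
  have cramer : A.det • v i = ∑ l, A.adjugate i l • ∑ j, A l j • v j := by
    simp only [Finset.smul_sum, smul_smul]
    rw [Finset.sum_comm]
    simp only [← Finset.sum_smul, ← Matrix.mul_apply, Matrix.adjugate_mul, Matrix.smul_apply,
      Matrix.one_apply, smul_eq_mul, mul_ite, mul_one, mul_zero, ite_smul, zero_smul,
      Finset.sum_ite_eq, Finset.mem_univ, if_true]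
  rw [cramer]
  exact N.sum_mem fun l _ => N.smul_mem _ (h l)

theorem det_one_sub_eq_one_of_rank_lt {R ι : Type*} [CommRing R] [Fintype ι] [DecidableEq ι]
    {J : Matrix ι ι R} (rank : ι → ℕ) (h : ∀ i j, J i j ≠ 0 → rank j < rank i) :
    (1 - J).det = 1 := by
  have hzero : ∀ i j, rank i ≤ rank j → J i j = 0 := fun i j hij =>
    by_contra fun hJ => (h i j hJ).not_ge hij
  have htri : (1 - J).BlockTriangular (OrderDual.toDual ∘ rank) := fun i j hij => by
    have hlt : rank i < rank j := hij
    have hne : i ≠ j := fun hEq => hlt.ne (congrArg rank hEq)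
    simp [hzero i j hlt.le, hne]
  rw [htri.det]
  refine Finset.prod_eq_one fun r _ => ?_
  have hblock : (1 - J).toSquareBlock (OrderDual.toDual ∘ rank) r = 1 := by
    ext ⟨i, hi⟩ ⟨j, hj⟩
    have hij : rank i = rank j := hi.trans hj.symm
    simp [Matrix.toSquareBlock_def, Matrix.one_apply, hzero i j hij.le]
  rw [hblock, Matrix.det_one]

end LinearAlgebra

section JacobianCriterion

variable {ι : Type*}

theorem derivation_mvPolynomial_aeval {k A M : Type*} [Fintype ι] [CommRing k] [CommRing A]
    [Algebra k A] [AddCommGroup M] [Module A M] [Module k M] (D : Derivation k A M) (x : ι → A)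
    (p : MvPolynomial ι k) :
    D (MvPolynomial.aeval x p) =
      ∑ j, MvPolynomial.aeval x (MvPolynomial.pderiv j p) • D (x j) := by
  classical
  induction p using MvPolynomial.induction_on with
  | C c => simp
  | add p q hp hq => simp [hp, hq, add_smul, Finset.sum_add_distrib]
  | mul_X p i hp =>
    simp [hp, Derivation.leibniz, MvPolynomial.pderiv_X, Pi.single_apply, add_smul, mul_smul,
      Finset.sum_add_distrib, Finset.smul_sum, apply_ite (MvPolynomial.aeval x)]

theorem derivation_eq_zero_of_adjoin_eq_top {k E M : Type*} [Field k] [Field E] [Algebra k E]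
    [AddCommGroup M] [Module E M] [Module k M] {s : Set E} (hs : IntermediateField.adjoin k s = ⊤)
    {D : Derivation k E M} (hD : ∀ x ∈ s, D x = 0) : D = 0 := by
  ext z
  have hz : z ∈ IntermediateField.adjoin k s := hs ▸ IntermediateField.mem_top
  induction hz using IntermediateField.adjoin_induction with
  | mem z hz => exact hD z hz
  | algebraMap c => exact D.map_algebraMap c
  | add a b _ _ ha hb => simp_all
  | inv a _ ha => simp_all [Derivation.leibniz_inv]
  | mul a b _ _ ha hb => simp_all

theorem isSeparable_of_kaehlerDifferential_eq_zero {k E : Type*} [Field k] [Field E] [Algebra k E]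
    {s : Set E} (hs : IntermediateField.adjoin k s = ⊤) (hfin : s.Finite)
    (hD : ∀ x ∈ s, KaehlerDifferential.D k E x = 0) : Algebra.IsSeparable k E := by
  have hzero := derivation_eq_zero_of_adjoin_eq_top hs hD
  have : Subsingleton (KaehlerDifferential k E) := by
    rw [← Submodule.subsingleton_iff E, ← subsingleton_iff_bot_eq_top,
      ← KaehlerDifferential.span_range_derivation, eq_comm, Submodule.span_eq_bot]
    rintro _ ⟨z, rfl⟩
    rw [hzero, Derivation.zero_apply]
  have : Algebra.FormallyUnramified k E := ⟨this⟩
  have : Algebra.EssFiniteType k E :=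
    IntermediateField.fg_top_iff.mp (hs ▸ IntermediateField.fg_adjoin_of_finite hfin)
  exact Algebra.FormallyUnramified.isSeparable k E

/-- The Jacobian matrix of the polynomials `P` at the point `x`. -/
noncomputable def jacobianAt {k A : Type*} [CommSemiring k] [CommSemiring A] [Algebra k A]
    (x : ι → A) (P : ι → MvPolynomial ι k) : Matrix ι ι A :=
  Matrix.of fun i j => MvPolynomial.aeval x (MvPolynomial.pderiv j (P i))

theorem jacobianAt_algHom {k A B : Type*} [CommSemiring k] [CommSemiring A] [CommSemiring B]
    [Algebra k A] [Algebra k B] (f : A →ₐ[k] B) (x : ι → A) (P : ι → MvPolynomial ι k) :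
    jacobianAt (f ∘ x) P = (jacobianAt x P).map f := by
  ext i j
  simp [jacobianAt, MvPolynomial.comp_aeval_apply, Function.comp_def]

theorem jacobianAt_map_algebraMap {k K A : Type*} [CommSemiring k] [CommSemiring K] [CommSemiring A]
    [Algebra k K] [Algebra k A] [Algebra K A] [IsScalarTower k K A] (x : ι → A)
    (P : ι → MvPolynomial ι k) :
    jacobianAt x (fun i => MvPolynomial.map (algebraMap k K) (P i)) = jacobianAt x P := by
  ext i j
  simp [jacobianAt, MvPolynomial.pderiv_map, MvPolynomial.aeval_map_algebraMap]

variable [Fintype ι] [DecidableEq ι]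

theorem det_one_sub_map {A B : Type*} [CommRing A] [CommRing B] (f : A →+* B) (J : Matrix ι ι A) :
    (1 - J.map f).det = f (1 - J).det := by
  rw [RingHom.map_det, map_sub, map_one, RingHom.mapMatrix_apply]

theorem isSeparable_of_det_one_sub_jacobianAt_ne_zero {k E : Type*} [Field k] [Field E]
    [Algebra k E] {x : ι → E} (hgen : IntermediateField.adjoin k (Set.range x) = ⊤)
    {P : ι → MvPolynomial ι k} (hx : ∀ i, MvPolynomial.aeval x (P i) = x i)
    (hdet : (1 - jacobianAt x P).det ≠ 0) : Algebra.IsSeparable k E := by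
  refine isSeparable_of_kaehlerDifferential_eq_zero hgen (Set.finite_range x) ?_
  rintro _ ⟨i, rfl⟩
  have hlinear : ∀ i, ∑ j, (1 - jacobianAt x P) i j • KaehlerDifferential.D k E (x j) = 0 :=
    fun i => by
      have := derivation_mvPolynomial_aeval (KaehlerDifferential.D k E) x (P i)
      rw [hx] at this
      simp [jacobianAt, sub_smul, Finset.sum_sub_distrib, ← this, Matrix.one_apply]
  have := det_smul_mem_of_forall_sum_smul_mem ⊥ (fun i => (Submodule.mem_bot E).mpr (hlinear i)) i
  exact (smul_eq_zero.mp ((Submodule.mem_bot E).mp this)).resolve_left hdet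

theorem isAlgebraic_of_det_one_sub_jacobianAt_ne_zero_of_field {k L : Type*} [Field k] [Field L]
    [Algebra k L] {x : ι → L} {P : ι → MvPolynomial ι k}
    (hx : ∀ i, MvPolynomial.aeval x (P i) = x i) (hdet : (1 - jacobianAt x P).det ≠ 0) (i : ι) :
    IsAlgebraic k (x i) := by
  let E := IntermediateField.adjoin k (Set.range x)
  let y : ι → E := fun i => ⟨x i, IntermediateField.subset_adjoin k _ ⟨i, rfl⟩⟩
  have hgen : IntermediateField.adjoin k (Set.range y) = ⊤ := by
    apply IntermediateField.lift_injective E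
    rw [IntermediateField.lift_adjoin, IntermediateField.lift_top, ← Set.range_comp]
    rfl
  have hy : ∀ i, MvPolynomial.aeval y (P i) = y i := fun i =>
    E.val.injective ((MvPolynomial.comp_aeval_apply y E.val (P i)).trans (hx i))
  have hdet' : (1 - jacobianAt y P).det ≠ 0 := fun h => by
    refine hdet ?_
    have := det_one_sub_map (E.val : E →+* L) (jacobianAt y P)
    rw [h, map_zero] at this
    exact (congrArg (fun J => (1 - J).det) (jacobianAt_algHom E.val y P)).trans this
  have hsep := isSeparable_of_det_one_sub_jacobianAt_ne_zero hgen hy hdet'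
  exact (hsep.isSeparable' (y i)).isIntegral.isAlgebraic.algHom E.val

theorem isAlgebraic_of_det_one_sub_jacobianAt_ne_zero {R S : Type*} [CommRing R] [IsDomain R]
    [CommRing S] [IsDomain S] [Algebra R S] [FaithfulSMul R S] {x : ι → S}
    {P : ι → MvPolynomial ι R} (hx : ∀ i, MvPolynomial.aeval x (P i) = x i)
    (hdet : (1 - jacobianAt x P).det ≠ 0) (i : ι) : IsAlgebraic R (x i) := by
  let K := FractionRing R
  let L := FractionRing S
  let _ : Algebra K L := FractionRing.liftAlgebra R L
  have hinj : Function.Injective (algebraMap S L) := IsFractionRing.injective S L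
  have hxL : ∀ i, MvPolynomial.aeval (algebraMap S L ∘ x)
      (MvPolynomial.map (algebraMap R K) (P i)) = algebraMap S L (x i) := fun i => by
    rw [MvPolynomial.aeval_map_algebraMap, MvPolynomial.aeval_algebraMap_apply, hx]
  have hdetL : (1 - jacobianAt (algebraMap S L ∘ x)
      fun i => MvPolynomial.map (algebraMap R K) (P i)).det ≠ 0 := by
    have := jacobianAt_algHom (IsScalarTower.toAlgHom R S L) x P
    rw [jacobianAt_map_algebraMap]
    refine fun h => hdet (hinj ?_)
    rw [← det_one_sub_map, map_zero, ← h]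
    exact congrArg (fun J => (1 - J).det) this.symm
  rw [← isAlgebraic_algebraMap_iff hinj, IsFractionRing.isAlgebraic_iff R K L]
  exact isAlgebraic_of_det_one_sub_jacobianAt_ne_zero_of_field hxL hdetL i

end JacobianCriterion

/-! ### Substitution of matrices into noncommutative series -/

section WordSeries

variable {T R : Type*} [CommRing R]

/-- The Cauchy product of two formal series in noncommuting variables, that is, of two functions on
words. -/
def wordConv (f g : List T → R) (w : List T) : R :=
  ∑ i ∈ Finset.range (w.length + 1), f (w.take i) * g (w.drop i)

theorem wordConv_nil (f g : List T → R) : wordConv f g [] = f [] * g [] := by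
  simp [wordConv]

open Classical in
/-- The formal series of a single word. -/
noncomputable def wordSingle (R : Type*) [CommRing R] (w v : List T) : R :=
  if v = w then 1 else 0

end WordSeries

section TransferMatrix

open Finset.HasAntidiagonal (antidiagonal)

variable {ι : Type*} [DecidableEq ι]

/-- The numbers of occurrences of the letters in a word. -/
noncomputable def wordContent (w : List ι) : ι →₀ ℕ :=
  Multiset.toFinsupp (w : Multiset ι)

theorem wordContent_append (u v : List ι) :
    wordContent (u ++ v) = wordContent u + wordContent v := by
  rw [wordContent, ← Multiset.coe_add, map_add, wordContent, wordContent]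

/-- The words with the content `m`. -/
noncomputable def wordsWithContent (m : ι →₀ ℕ) : Finset (List ι) :=
  (Finsupp.toMultiset m).lists.toFinset

theorem mem_wordsWithContent {m : ι →₀ ℕ} {w : List ι} :
    w ∈ wordsWithContent m ↔ wordContent w = m := by
  rw [wordsWithContent, Multiset.mem_toFinset, Multiset.mem_lists_iff, Multiset.quot_mk_to_coe,
    wordContent, Multiset.toFinsupp_eq_iff, eq_comm]

theorem wordsWithContent_zero : wordsWithContent (0 : ι →₀ ℕ) = {[]} := by
  ext w
  simp [mem_wordsWithContent, wordContent]

theorem sum_wordsWithContent_take_drop {R : Type*} [AddCommMonoid R] (F : List ι → List ι → R)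
    (m : ι →₀ ℕ) :
    ∑ w ∈ wordsWithContent m, ∑ i ∈ Finset.range (w.length + 1), F (w.take i) (w.drop i) =
      ∑ p ∈ antidiagonal m, ∑ u ∈ wordsWithContent p.1, ∑ v ∈ wordsWithContent p.2,
        F u v := by
  simp only [← Finset.sum_product']
  rw [Finset.sum_sigma', Finset.sum_sigma']
  refine Finset.sum_bij'
    (fun z _ => ⟨(wordContent (z.1.take z.2), wordContent (z.1.drop z.2)),
      (z.1.take z.2, z.1.drop z.2)⟩)
    (fun z _ => ⟨z.2.1 ++ z.2.2, z.2.1.length⟩) ?_ ?_ ?_ ?_ ?_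
  · rintro ⟨w, i⟩ hz
    simp_all [mem_wordsWithContent, ← wordContent_append]
  · rintro ⟨⟨p, q⟩, u, v⟩ hz
    simp_all [mem_wordsWithContent, wordContent_append]
  · rintro ⟨w, i⟩ hz
    simp_all
  · rintro ⟨⟨p, q⟩, u, v⟩ hz
    simp_all [mem_wordsWithContent]
  · simp

variable {T R n : Type*} [CommRing R] [Fintype n] [DecidableEq n]

/-- The image of the formal series `f` in noncommuting variables under the substitution, for each
letter `x i` with `i : ι`, of the matrix `Xᵢ • E i`, all other letters being replaced by zero. -/
noncomputable def transferMatrix (E : ι → Matrix n n R) (x : ι → T) (f : List T → R) :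
    Matrix n n (MvPowerSeries ι R) :=
  Matrix.of fun s t m => ∑ w ∈ wordsWithContent m, f (w.map x) * (w.map E).prod s t

variable (E : ι → Matrix n n R) (x : ι → T)

theorem coeff_transferMatrix (f : List T → R) (s t : n) (m : ι →₀ ℕ) :
    MvPowerSeries.coeff m (transferMatrix E x f s t) =
      ∑ w ∈ wordsWithContent m, f (w.map x) * (w.map E).prod s t :=
  rfl

theorem constantCoeff_transferMatrix (f : List T → R) (s : n) :
    MvPowerSeries.constantCoeff (transferMatrix E x f s s) = f [] := by
  rw [← MvPowerSeries.coeff_zero_eq_constantCoeff_apply, coeff_transferMatrix,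
    wordsWithContent_zero]
  simp

theorem transferMatrix_wordConv (f g : List T → R) :
    transferMatrix E x (wordConv f g) = transferMatrix E x f * transferMatrix E x g := by
  ext s t m
  rw [Matrix.mul_apply, map_sum]
  simp only [MvPowerSeries.coeff_mul, coeff_transferMatrix, wordConv]
  calc ∑ w ∈ wordsWithContent m, (∑ i ∈ Finset.range ((w.map x).length + 1),
          f ((w.map x).take i) * g ((w.map x).drop i)) * (w.map E).prod s t
      = ∑ w ∈ wordsWithContent m, ∑ i ∈ Finset.range (w.length + 1),
          f ((w.take i).map x) * g ((w.drop i).map x) *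
            (((w.take i).map E).prod * ((w.drop i).map E).prod) s t := by
        simp only [List.map_take, List.map_drop, List.prod_take_mul_prod_drop, List.length_map,
          Finset.sum_mul]
    _ = ∑ p ∈ antidiagonal m, ∑ u ∈ wordsWithContent p.1, ∑ v ∈ wordsWithContent p.2,
          f (u.map x) * g (v.map x) * ((u.map E).prod * (v.map E).prod) s t :=
        sum_wordsWithContent_take_drop
          (fun u v => f (u.map x) * g (v.map x) * ((u.map E).prod * (v.map E).prod) s t) m
    _ = ∑ r, ∑ p ∈ antidiagonal m,
          (∑ u ∈ wordsWithContent p.1, f (u.map x) * (u.map E).prod s r) *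
            ∑ v ∈ wordsWithContent p.2, g (v.map x) * (v.map E).prod r t := by
        rw [Finset.sum_comm]
        refine Finset.sum_congr rfl fun p _ => ?_
        simp only [Finset.sum_mul_sum]
        simp only [Matrix.mul_apply, Finset.mul_sum]
        rw [Finset.sum_comm_cycle]
        simp only [mul_mul_mul_comm]

theorem transferMatrix_wordSingle_nil : transferMatrix E x (wordSingle R []) = 1 := by
  ext s t m
  have hne : ∀ w ∈ wordsWithContent m, w ≠ [] →
      wordSingle R ([] : List T) (w.map x) * (w.map E).prod s t = 0 := fun w _ hw => by
    simp [wordSingle, hw]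
  rw [coeff_transferMatrix]
  rcases eq_or_ne m 0 with rfl | hm
  · by_cases hst : s = t <;> simp [wordsWithContent_zero, wordSingle, Matrix.one_apply, hst]
  · rw [Finset.sum_eq_zero fun w hw => hne w hw ?_]
    · simp [Matrix.one_apply, MvPowerSeries.coeff_one, apply_ite, hm]
    · rintro rfl
      exact hm (mem_wordsWithContent.mp hw).symm

open Classical in
theorem transferMatrix_wordSingle_singleton (a : T) (s t : n) [Fintype ι] :
    transferMatrix E x (wordSingle R [a]) s t =
      ∑ j with x j = a, E j s t • MvPowerSeries.X j := by
  ext m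
  rw [coeff_transferMatrix, map_sum]
  simp only [wordSingle, ite_mul, one_mul, zero_mul, map_smul, MvPowerSeries.coeff_X, smul_eq_mul,
    mul_ite, mul_one, mul_zero]
  rw [← Finset.sum_filter, ← Finset.sum_filter, Finset.filter_filter]
  refine (Finset.sum_bij (fun j _ => [j]) ?_ ?_ ?_ ?_).symm
  · intro j hj
    simp_all [mem_wordsWithContent, wordContent]
  · simp
  · intro w hw
    obtain ⟨hcontent, hw⟩ := Finset.mem_filter.mp hw
    obtain ⟨j, rfl, hj⟩ := List.map_eq_singleton_iff.mp hw
    refine ⟨j, ?_, rfl⟩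
    simp_all [mem_wordsWithContent, wordContent]
  · simp

theorem transferMatrix_sum {κ : Type*} (S : Finset κ) (f : κ → List T → R) :
    transferMatrix E x (∑ i ∈ S, f i) = ∑ i ∈ S, transferMatrix E x (f i) := by
  ext s t m
  rw [Matrix.sum_apply, map_sum]
  simp only [coeff_transferMatrix, Finset.sum_apply, Finset.sum_mul]
  exact Finset.sum_comm

end TransferMatrix

section SingleVariable

variable {σ k : Type*} [CommRing k]

open Classical in
theorem coeff_toMvPowerSeries (i : σ) (f : PowerSeries k) (m : σ →₀ ℕ) :
    MvPowerSeries.coeff m (f.toMvPowerSeries i) =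
      if m = Finsupp.single i (m i) then f.coeff (m i) else 0 := by
  split_ifs with h
  · have := MvPowerSeries.coeff_embDomain_rename (Function.Embedding.punit i) f
      (Finsupp.single () (m i))
    rw [Finsupp.embDomain_single] at this
    rw [h, Finsupp.single_eq_same]
    exact this
  · refine MvPowerSeries.coeff_rename_eq_zero _ _ ?_
    rintro ⟨x, rfl⟩
    refine h ?_
    rw [Finsupp.unique_single x, Finsupp.mapDomain_single, Finsupp.single_eq_same]

theorem mem_range_toMvPowerSeries {i : σ} {f : MvPowerSeries σ k}
    (h : ∀ m, MvPowerSeries.coeff m f ≠ 0 → m = Finsupp.single i (m i)) :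
    f ∈ (PowerSeries.toMvPowerSeries (R := k) i).range := by
  classical
  refine ⟨PowerSeries.mk fun n => MvPowerSeries.coeff (Finsupp.single i n) f, ?_⟩
  ext m
  change MvPowerSeries.coeff m (PowerSeries.toMvPowerSeries i _) = _
  rw [coeff_toMvPowerSeries]
  split_ifs with hm
  · rw [PowerSeries.coeff_mk, ← hm]
  · exact (not_imp_comm.mp (h m) hm).symm

end SingleVariable

section SortedMatrix

variable {ι R : Type*} [LinearOrder ι] [CommRing R]

/-- The transition matrix of the letter `j` in the automaton with the set of states `ι` that enters
the state `j` upon reading `j`, provided that its state was not greater.  Started in `s`, it accepts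
exactly the sorted words in letters not less than `s`. -/
def enterMatrix (R : Type*) [CommRing R] (j : ι) : Matrix ι ι R :=
  Matrix.of fun s t => if s ≤ j ∧ t = j then 1 else 0

variable [Fintype ι]

theorem prod_map_enterMatrix_cons (j : ι) (w : List ι) (s t : ι) :
    ((j :: w).map (enterMatrix R)).prod s t =
      if s ≤ j then (w.map (enterMatrix R)).prod j t else 0 := by
  rw [List.map_cons, List.prod_cons, Matrix.mul_apply, Finset.sum_eq_single j]
  · simp [enterMatrix]
  · intro u _ hu
    simp [enterMatrix, hu]
  · simp

theorem le_and_forall_mem_of_prod_map_enterMatrix_ne_zero {w : List ι} {s t : ι}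
    (h : (w.map (enterMatrix R)).prod s t ≠ 0) : s ≤ t ∧ ∀ j ∈ w, s ≤ j ∧ j ≤ t := by
  induction w generalizing s with
  | nil =>
    have hst : s = t := by_contra fun hst => h (Matrix.one_apply_ne hst)
    simp [hst]
  | cons i w ih =>
    rw [prod_map_enterMatrix_cons] at h
    obtain ⟨hsi, hw⟩ := ite_ne_right_iff.mp h
    obtain ⟨hit, hmem⟩ := ih hw
    refine ⟨hsi.trans hit, fun j hj => ?_⟩
    rcases List.mem_cons.mp hj with rfl | hj
    exacts [⟨hsi, hit⟩, ⟨hsi.trans (hmem j hj).1, (hmem j hj).2⟩]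

variable {T : Type*} (x : ι → T)

/-- The `(s, t)` entry collects the values of `f` at the nonempty sorted words in the letters
`x s, …, x t` with the last letter `x t`, and also at the empty word if `s = t`. -/
noncomputable def sortedMatrix (x : ι → T) (f : List T → R) : Matrix ι ι (MvPowerSeries ι R) :=
  transferMatrix (enterMatrix R) x f

theorem sortedMatrix_apply_of_lt (f : List T → R) {s t : ι} (h : t < s) :
    sortedMatrix x f s t = 0 := by
  ext m
  rw [sortedMatrix, coeff_transferMatrix]
  refine Finset.sum_eq_zero fun w _ => ?_
  rw [not_imp_comm.mp (fun hw => (le_and_forall_mem_of_prod_map_enterMatrix_ne_zero hw).1) h.not_ge,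
    mul_zero]

theorem sortedMatrix_wordConv_apply (f g : List T → R) (s t : ι) :
    sortedMatrix x (wordConv f g) s t =
      ∑ u, sortedMatrix x f s u * sortedMatrix x g u t := by
  rw [sortedMatrix, transferMatrix_wordConv, Matrix.mul_apply]
  rfl

theorem sortedMatrix_wordConv_self (f g : List T → R) (s : ι) :
    sortedMatrix x (wordConv f g) s s = sortedMatrix x f s s * sortedMatrix x g s s := by
  rw [sortedMatrix_wordConv_apply, Finset.sum_eq_single_of_mem s (Finset.mem_univ s)]
  intro u _ hu
  rcases hu.lt_or_gt with hu | hu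
  · rw [sortedMatrix_apply_of_lt x f hu, zero_mul]
  · rw [sortedMatrix_apply_of_lt x g hu, mul_zero]

open Classical in
theorem sortedMatrix_wordSingle_singleton (a : T) (s t : ι) :
    sortedMatrix x (wordSingle R [a]) s t =
      if s ≤ t ∧ x t = a then MvPowerSeries.X t else 0 := by
  rw [sortedMatrix, transferMatrix_wordSingle_singleton, Finset.sum_filter,
    Finset.sum_eq_single_of_mem t (Finset.mem_univ t)]
  · by_cases hst : s ≤ t <;> simp [enterMatrix, hst]
  · intro j _ hj
    simp [enterMatrix, hj.symm]

theorem sortedMatrix_wordSingle_mem {S : Type*} [SetLike S (MvPowerSeries ι R)]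
    [ZeroMemClass S (MvPowerSeries ι R)] {A : S} (a : T) {s t : ι}
    (ht : MvPowerSeries.X t ∈ A) : sortedMatrix x (wordSingle R [a]) s t ∈ A := by
  rw [sortedMatrix_wordSingle_singleton]
  split_ifs
  exacts [ht, zero_mem A]

theorem sortedMatrix_self_mem_range (f : List T → R) (s : ι) :
    sortedMatrix x f s s ∈ (PowerSeries.toMvPowerSeries (R := R) s).range := by
  refine mem_range_toMvPowerSeries fun m hm => ?_
  rw [sortedMatrix, coeff_transferMatrix] at hm
  obtain ⟨w, hw, hne⟩ := Finset.exists_ne_zero_of_sum_ne_zero hm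
  have hall : ∀ j ∈ w, j = s := fun j hj =>
    have h := (le_and_forall_mem_of_prod_map_enterMatrix_ne_zero (right_ne_zero_of_mul hne)).2 j hj
    le_antisymm h.2 h.1
  rw [← mem_wordsWithContent.mp hw, List.eq_replicate_of_mem hall]
  have hcontent : wordContent (List.replicate w.length s) = Finsupp.single s w.length := by
    ext j
    simp [wordContent, List.count_replicate, Finsupp.single_apply]
  rw [hcontent, Finsupp.single_eq_same]

end SortedMatrix

/-! ### Algebraic series in one variable, and denominators in two -/

section AlgebraicSeries

variable {σ k : Type*} [Field k]

instance : IsDomain (MvPowerSeries σ k) :=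
  NoZeroDivisors.to_isDomain _

/-- The power series that are algebraic over the polynomials in the variables of `s`. -/
noncomputable def algebraicSeriesOver (k : Type*) [Field k] (s : Set σ) :
    Subalgebra k (MvPowerSeries σ k) :=
  (Subalgebra.algebraicClosure (MvPolynomial.supported k s) (MvPowerSeries σ k)).restrictScalars k

theorem coe_mem_algebraicSeriesOver {s : Set σ} {p : MvPolynomial σ k}
    (hp : p ∈ MvPolynomial.supported k s) : (p : MvPowerSeries σ k) ∈ algebraicSeriesOver k s :=
  isAlgebraic_algebraMap (⟨p, hp⟩ : MvPolynomial.supported k s)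

theorem algebraicSeriesOver_mono {s t : Set σ} (h : s ⊆ t) :
    algebraicSeriesOver k s ≤ algebraicSeriesOver k t := fun f hf => by
  let φ : MvPolynomial.supported k s →+* MvPolynomial.supported k t :=
    (Subalgebra.inclusion (MvPolynomial.supported_mono (R := k) h)).toRingHom
  exact IsAlgebraic.ringHom_of_comp_eq φ (RingHom.id (MvPowerSeries σ k)) hf
    (Subalgebra.inclusion_injective _) rfl

/-- The power series in the single variable `i` that are algebraic over the polynomials in this
variable. -/
noncomputable def univariateAlgebraic (k : Type*) [Field k] (i : σ) :
    Subalgebra k (MvPowerSeries σ k) :=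
  (PowerSeries.toMvPowerSeries i).range ⊓ algebraicSeriesOver k {i}

theorem X_mem_univariateAlgebraic (k : Type*) [Field k] (i : σ) :
    (MvPowerSeries.X i : MvPowerSeries σ k) ∈ univariateAlgebraic k i := by
  refine ⟨⟨PowerSeries.X, PowerSeries.toMvPowerSeries_X i⟩, ?_⟩
  rw [← MvPolynomial.coe_X]
  exact coe_mem_algebraicSeriesOver (MvPolynomial.X_mem_supported.mpr rfl)

theorem coe_mem_of_forall_X_mem {s : Set σ} {A : Subalgebra k (MvPowerSeries σ k)}
    (hA : ∀ i ∈ s, MvPowerSeries.X i ∈ A) {p : MvPolynomial σ k}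
    (hp : p ∈ MvPolynomial.supported k s) : (p : MvPowerSeries σ k) ∈ A := by
  have hle : MvPolynomial.supported k s ≤ A.comap (MvPolynomial.coeToMvPowerSeries.algHom k) := by
    refine Algebra.adjoin_le ?_
    rintro _ ⟨i, hi, rfl⟩
    simpa using hA i hi
  simpa using hle hp

theorem exists_mul_eq_algebraMap_of_isAlgebraic {P K : Type*} [CommRing P] [CommRing K]
    [IsDomain K] [Algebra P K] {S : Subring K} (hPS : ∀ p, algebraMap P K p ∈ S)
    {e : K} (he : e ∈ S) (he0 : e ≠ 0) (halg : IsAlgebraic P e) :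
    ∃ e' ∈ S, ∃ p, p ≠ 0 ∧ e * e' = algebraMap P K p := by
  let S' : Subalgebra P K := { S with algebraMap_mem' := hPS }
  have halg' : IsAlgebraic P (⟨e, he⟩ : S') :=
    (isAlgebraic_algebraMap_iff (Subtype.val_injective (p := (· ∈ S')))).mp halg
  obtain ⟨p, hp0, e', he'⟩ := halg'.exists_nonzero_dvd
    (mem_nonZeroDivisors_of_ne_zero fun h => he0 (congrArg Subtype.val h))
  exact ⟨e', e'.2, p, hp0, (congrArg Subtype.val he').symm⟩

theorem exists_mul_eq_coe_of_mem_sup {i j : σ} {e : MvPowerSeries σ k}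
    (he : e ∈ univariateAlgebraic k i ⊔ univariateAlgebraic k j) (he0 : e ≠ 0) :
    ∃ e' ∈ univariateAlgebraic k i ⊔ univariateAlgebraic k j,
      ∃ p ∈ MvPolynomial.supported k {i, j}, p ≠ 0 ∧ e * e' = p := by
  have hX : ∀ l ∈ ({i, j} : Set σ), MvPowerSeries.X l ∈
      univariateAlgebraic k i ⊔ univariateAlgebraic k j := by
    rintro l (rfl | rfl)
    exacts [Algebra.mem_sup_left (X_mem_univariateAlgebraic k l),
      Algebra.mem_sup_right (X_mem_univariateAlgebraic k l)]
  have hle : univariateAlgebraic k i ⊔ univariateAlgebraic k j ≤ algebraicSeriesOver k {i, j} :=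
    sup_le (inf_le_right.trans (algebraicSeriesOver_mono (by simp)))
      (inf_le_right.trans (algebraicSeriesOver_mono (by simp)))
  obtain ⟨e', he', p, hp0, hp⟩ := exists_mul_eq_algebraMap_of_isAlgebraic
    (S := (univariateAlgebraic k i ⊔ univariateAlgebraic k j).toSubring)
    (fun p => coe_mem_of_forall_X_mem hX p.2) he he0 (hle he)
  exact ⟨e', he', p, p.2, fun h => hp0 (Subtype.ext h), hp⟩

end AlgebraicSeries

section Denominators

/-- The elements that are fractions with a numerator in `A` and a denominator in `D`. -/
def denominatorClosure {k K : Type*} [CommRing k] [CommRing K] [Algebra k K] (A : Subalgebra k K)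
    (D : Submonoid K) (hD : D ≤ A.toSubmonoid) : Subalgebra k K where
  carrier := {f | ∃ d ∈ D, d * f ∈ A}
  mul_mem' := by
    rintro f g ⟨d, hd, hf⟩ ⟨e, he, hg⟩
    exact ⟨d * e, D.mul_mem hd he, mul_mul_mul_comm d e f g ▸ A.mul_mem hf hg⟩
  add_mem' := by
    rintro f g ⟨d, hd, hf⟩ ⟨e, he, hg⟩
    refine ⟨d * e, D.mul_mem hd he, ?_⟩
    rw [show d * e * (f + g) = e * (d * f) + d * (e * g) by ring]
    exact A.add_mem (A.mul_mem (hD he) hf) (A.mul_mem (hD hd) hg)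
  algebraMap_mem' c := ⟨1, D.one_mem, A.mul_mem A.one_mem (A.algebraMap_mem c)⟩

theorem le_denominatorClosure {k K : Type*} [CommRing k] [CommRing K] [Algebra k K]
    (A : Subalgebra k K) (D : Submonoid K) (hD : D ≤ A.toSubmonoid) :
    A ≤ denominatorClosure A D hD := fun f hf => ⟨1, D.one_mem, by rwa [one_mul]⟩

variable {σ k : Type*} [Field k]

/-- The products of nonzero polynomials, each of which depends on at most two variables. -/
noncomputable def bivariateProducts (σ k : Type*) [Field k] : Submonoid (MvPolynomial σ k) :=
  Submonoid.closure {p | p ≠ 0 ∧ ∃ i j, p ∈ MvPolynomial.supported k {i, j}}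

theorem mem_bivariateProducts {p : MvPolynomial σ k} (hp0 : p ≠ 0) {i j : σ}
    (hp : p ∈ MvPolynomial.supported k {i, j}) : p ∈ bivariateProducts σ k :=
  Submonoid.subset_closure ⟨hp0, i, j, hp⟩

theorem map_bivariateProducts_le :
    (bivariateProducts σ k).map MvPolynomial.coeToMvPowerSeries.ringHom ≤
      (⨆ i, univariateAlgebraic k i : Subalgebra k (MvPowerSeries σ k)).toSubmonoid := by
  rintro _ ⟨p, -, rfl⟩
  exact coe_mem_of_forall_X_mem (s := Set.univ)
    (fun i _ => le_iSup (univariateAlgebraic k) i (X_mem_univariateAlgebraic k i))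
    (MvPolynomial.supported_univ (σ := σ) (R := k) ▸ Algebra.mem_top)

/-- The fractions whose numerators are sums of products of algebraic power series in one variable
each and whose denominators are products of polynomials in two variables each. -/
noncomputable def separatedAlgebraic (σ k : Type*) [Field k] : Subalgebra k (MvPowerSeries σ k) :=
  denominatorClosure (⨆ i, univariateAlgebraic k i)
    ((bivariateProducts σ k).map MvPolynomial.coeToMvPowerSeries.ringHom) map_bivariateProducts_le

theorem mem_separatedAlgebraic {f : MvPowerSeries σ k} :
    f ∈ separatedAlgebraic σ k ↔
      ∃ p ∈ bivariateProducts σ k, (p : MvPowerSeries σ k) * f ∈ ⨆ i, univariateAlgebraic k i :=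
  ⟨fun ⟨_, ⟨p, hp, h⟩, hf⟩ => ⟨p, hp, by rw [← h] at hf; exact hf⟩,
    fun ⟨p, hp, hf⟩ => ⟨p, ⟨p, hp, rfl⟩, hf⟩⟩

theorem univariateAlgebraic_le_separatedAlgebraic (i : σ) :
    univariateAlgebraic k i ≤ separatedAlgebraic σ k :=
  (le_iSup (univariateAlgebraic k) i).trans (le_denominatorClosure _ _ _)

theorem mem_separatedAlgebraic_of_mul_mem {i j : σ} {e f : MvPowerSeries σ k}
    (he : e ∈ univariateAlgebraic k i ⊔ univariateAlgebraic k j) (he0 : e ≠ 0)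
    (hef : e * f ∈ separatedAlgebraic σ k) : f ∈ separatedAlgebraic σ k := by
  obtain ⟨e', he', p, hp, hp0, hmul⟩ := exists_mul_eq_coe_of_mem_sup he he0
  have hmem : e' * (e * f) ∈ separatedAlgebraic σ k :=
    mul_mem (sup_le (univariateAlgebraic_le_separatedAlgebraic i)
      (univariateAlgebraic_le_separatedAlgebraic j) he') hef
  rw [← mul_assoc, mul_comm e', hmul] at hmem
  obtain ⟨q, hq, hqf⟩ := mem_separatedAlgebraic.mp hmem
  refine mem_separatedAlgebraic.mpr ⟨q * p, mul_mem hq (mem_bivariateProducts hp0 hp), ?_⟩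
  rwa [MvPolynomial.coe_mul, mul_assoc]

end Denominators

/-! ### Polynomial systems for noncommutative series -/

section Systems

variable {T N R : Type*} [CommRing R]

/-- The formal series of a symbol, for given series of the nonterminals. -/
noncomputable def symbolSeries (F : N → List T → R) : Symbol T N → List T → R
  | .terminal t => wordSingle R [t]
  | .nonterminal A => F A

/-- The formal series of a sentential form, for given series of the nonterminals. -/
noncomputable def formSeries (F : N → List T → R) : List (Symbol T N) → List T → R
  | [] => wordSingle R []
  | X :: α => wordConv (symbolSeries F X) (formSeries F α)

theorem formSeries_nil (F : N → List T → R) (α : List (Symbol T N)) :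
    formSeries F α [] = (α.map fun X => symbolSeries F X []).prod := by
  induction α with
  | nil => simp [formSeries, wordSingle]
  | cons X α ih => rw [formSeries, wordConv_nil, ih, List.map_cons, List.prod_cons]

open Classical in
/-- The sum, over all occurrences of the nonterminal `B` in a sentential form, of the product of the
values of `φ` to the left of the occurrence and of the values of `ψ` to the right of it.  For
`φ = ψ` this is the partial derivative of the product of all values. -/
noncomputable def occurrenceSum (φ ψ : Symbol T N → R) (B : N) : List (Symbol T N) → R
  | [] => 0
  | X :: α => (if X = .nonterminal B then (α.map ψ).prod else 0) + φ X * occurrenceSum φ ψ B α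

theorem exists_split_of_map_occurrenceSum_ne_zero {K : Type*} [CommRing K] [NoZeroDivisors R]
    (χ : K →+* R) {φ ψ : Symbol T N → K} {ε : Symbol T N → R} (hφ : ∀ X, χ (φ X) = ε X)
    (hψ : ∀ X, χ (ψ X) = ε X) {B : N} {α : List (Symbol T N)}
    (h : χ (occurrenceSum φ ψ B α) ≠ 0) :
    ∃ β γ, α = β ++ .nonterminal B :: γ ∧ (β.map ε).prod ≠ 0 ∧ (γ.map ε).prod ≠ 0 := by
  have : Nontrivial R := nontrivial_of_ne _ _ h
  induction α with
  | nil => exact absurd (map_zero χ) h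
  | cons X α ih =>
    rw [occurrenceSum, map_add, map_mul] at h
    by_cases hfirst : χ (if X = .nonterminal B then (α.map ψ).prod else 0) = 0
    · rw [hfirst, zero_add] at h
      obtain ⟨β, γ, rfl, hβ, hγ⟩ := ih (right_ne_zero_of_mul h)
      refine ⟨X :: β, γ, rfl, ?_, hγ⟩
      rw [List.map_cons, List.prod_cons, ← hφ]
      exact mul_ne_zero (left_ne_zero_of_mul h) hβ
    · split_ifs at hfirst with hX
      · refine ⟨[], α, by rw [hX]; rfl, by simp, ?_⟩
        rwa [map_list_prod, List.map_map, show χ ∘ ψ = ε from funext hψ] at hfirst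
      · exact absurd (map_zero χ) hfirst

theorem sub_sum_occurrenceSum_smul_mem [Fintype N] {M : Type*} [AddCommGroup M] [Module R M]
    (V : Submodule R M) {φ ψ : Symbol T N → R} {μ : Symbol T N → M} {v : List (Symbol T N) → M}
    (hnil : v [] ∈ V) (hterminal : ∀ t, μ (.terminal t) ∈ V)
    (hcons : ∀ X α, v (X :: α) - (φ X • v α + (α.map ψ).prod • μ X) ∈ V)
    (α : List (Symbol T N)) :
    v α - ∑ B, occurrenceSum φ ψ B α • μ (.nonterminal B) ∈ V := by
  classical
  induction α with
  | nil => simpa [occurrenceSum] using hnil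
  | cons X α ih =>
    have hsum : ∑ B, occurrenceSum φ ψ B (X :: α) • μ (.nonterminal B) =
        (α.map ψ).prod • (∑ B, if X = .nonterminal B then μ (.nonterminal B) else 0) +
          φ X • ∑ B, occurrenceSum φ ψ B α • μ (.nonterminal B) := by
      simp only [occurrenceSum, add_smul, Finset.sum_add_distrib, Finset.smul_sum, smul_smul,
        smul_ite, ite_smul, smul_zero, zero_smul]
    have hX : μ X - (∑ B, if X = .nonterminal B then μ (.nonterminal B) else 0) ∈ V := by
      cases X with
      | terminal t => simpa using hterminal t
      | nonterminal A => simp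
    rw [hsum]
    have := V.add_mem (V.add_mem (hcons X α) (V.smul_mem (φ X) ih))
      (V.smul_mem (α.map ψ).prod hX)
    convert this using 1
    simp only [smul_sub]
    abel

/-- The polynomial of a symbol for the given constants of the terminals, with the nonterminals as
the variables. -/
noncomputable def symbolPolynomial (c : T → R) : Symbol T N → MvPolynomial N R
  | .terminal t => MvPolynomial.C (c t)
  | .nonterminal B => MvPolynomial.X B

section SymbolPolynomial

variable {L : Type*} [CommRing L] [Algebra R L] {c : T → R} {φ : Symbol T N → L}
  (hterminal : ∀ t, φ (.terminal t) = algebraMap R L (c t))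

include hterminal

theorem aeval_symbolPolynomial (X : Symbol T N) :
    MvPolynomial.aeval (fun A => φ (.nonterminal A)) (symbolPolynomial c X) = φ X := by
  cases X <;> simp [symbolPolynomial, hterminal]

theorem aeval_prod_symbolPolynomial (α : List (Symbol T N)) :
    MvPolynomial.aeval (fun A => φ (.nonterminal A)) (α.map (symbolPolynomial c)).prod =
      (α.map φ).prod := by
  rw [map_list_prod, List.map_map]
  exact congrArg List.prod (List.map_congr_left fun X _ => aeval_symbolPolynomial hterminal X)

theorem aeval_pderiv_prod_symbolPolynomial (B : N) (α : List (Symbol T N)) :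
    MvPolynomial.aeval (fun A => φ (.nonterminal A))
      (MvPolynomial.pderiv B (α.map (symbolPolynomial c)).prod) = occurrenceSum φ φ B α := by
  classical
  induction α with
  | nil => simp [occurrenceSum]
  | cons X α ih =>
    rw [List.map_cons, List.prod_cons, Derivation.leibniz, map_add, smul_eq_mul, smul_eq_mul,
      map_mul, map_mul, ih, aeval_symbolPolynomial hterminal,
      aeval_prod_symbolPolynomial hterminal, occurrenceSum, add_comm]
    rcases X with t | C
    · simp [symbolPolynomial]
    · by_cases hC : C = B <;> simp [symbolPolynomial, hC, MvPolynomial.pderiv_X]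

end SymbolPolynomial

/-- A finite system of equations for formal series such that the dependence of the constant terms of
these series on one another is acyclic. -/
structure RegularSystem (T N R : Type*) [CommRing R] where
  /-- The right-hand sides of the rules for a nonterminal. -/
  rules : N → Finset (List (Symbol T N))
  /-- The series of a nonterminal. -/
  series : N → List T → R
  series_eq : ∀ A, series A = ∑ β ∈ rules A, formSeries series β
  /-- A rank that decreases along the dependence of the constant terms. -/
  rank : N → ℕ
  rank_lt : ∀ A (α γ : List (Symbol T N)) (B : N), α ++ .nonterminal B :: γ ∈ rules A →
    formSeries series α [] ≠ 0 → formSeries series γ [] ≠ 0 → rank B < rank A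

end Systems

namespace RegularSystem

variable {T N R : Type*} [CommRing R] (P : RegularSystem T N R)

/-- The matrix of the linearisation of the system, with the values of `φ` substituted to the left of
a nonterminal and those of `ψ` to the right of it. -/
noncomputable def jacobian {K : Type*} [CommRing K] (φ ψ : Symbol T N → K) : Matrix N N K :=
  Matrix.of fun A B => ∑ β ∈ P.rules A, occurrenceSum φ ψ B β

section Jacobian

variable [Fintype N] [DecidableEq N]

theorem det_one_sub_jacobian_ne_zero [IsDomain R] {K : Type*} [CommRing K] (χ : K →+* R)
    {φ ψ : Symbol T N → K} (hφ : ∀ X, χ (φ X) = symbolSeries P.series X [])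
    (hψ : ∀ X, χ (ψ X) = symbolSeries P.series X []) : (1 - P.jacobian φ ψ).det ≠ 0 := by
  have hrank : ∀ A B, (P.jacobian φ ψ).map χ A B ≠ 0 → P.rank B < P.rank A := fun A B h => by
    rw [jacobian, Matrix.map_apply, Matrix.of_apply, map_sum] at h
    obtain ⟨β, hβ, hne⟩ := Finset.exists_ne_zero_of_sum_ne_zero h
    obtain ⟨α, γ, rfl, hα, hγ⟩ := exists_split_of_map_occurrenceSum_ne_zero χ hφ hψ hne
    exact P.rank_lt A α γ B hβ (formSeries_nil P.series α ▸ hα) (formSeries_nil P.series γ ▸ hγ)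
  intro hdet
  have hone := det_one_sub_eq_one_of_rank_lt P.rank hrank
  rw [det_one_sub_map, hdet, map_zero] at hone
  exact zero_ne_one hone

theorem det_one_sub_jacobian_smul_mem {K M : Type*} [CommRing K] [AddCommGroup M] [Module K M]
    (V : Submodule K M) {φ ψ : Symbol T N → K} {μ : Symbol T N → M} {v : List (Symbol T N) → M}
    (hnil : v [] ∈ V) (hterminal : ∀ t, μ (.terminal t) ∈ V)
    (hcons : ∀ X α, v (X :: α) - (φ X • v α + (α.map ψ).prod • μ X) ∈ V)
    (heq : ∀ A, μ (.nonterminal A) = ∑ β ∈ P.rules A, v β) (A : N) :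
    (1 - P.jacobian φ ψ).det • μ (.nonterminal A) ∈ V := by
  refine det_smul_mem_of_forall_sum_smul_mem V (v := fun A => μ (.nonterminal A)) (fun A => ?_) A
  have hrow : ∑ B, (1 - P.jacobian φ ψ) A B • μ (.nonterminal B) =
      ∑ β ∈ P.rules A, (v β - ∑ B, occurrenceSum φ ψ B β • μ (.nonterminal B)) := by
    simp only [Matrix.sub_apply, Matrix.one_apply, sub_smul, ite_smul, one_smul, zero_smul,
      Finset.sum_sub_distrib, Finset.sum_ite_eq, Finset.mem_univ, if_true, ← heq, jacobian,
      Matrix.of_apply, Finset.sum_smul]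
    rw [Finset.sum_comm]
  rw [hrow]
  exact V.sum_mem fun β _ => sub_sum_occurrenceSum_smul_mem V hnil hterminal hcons β

end Jacobian

theorem isAlgebraic_of_forall_eq_sum [Finite N] [IsDomain R] {K L : Type*} [CommRing K] [IsDomain K]
    [CommRing L] [IsDomain L] [Algebra K L] [FaithfulSMul K L] (χ : L →+* R)
    {φ : Symbol T N → L} (c : T → K) (hterminal : ∀ t, φ (.terminal t) = algebraMap K L (c t))
    (heq : ∀ A, φ (.nonterminal A) = ∑ β ∈ P.rules A, (β.map φ).prod)
    (hχ : ∀ X, χ (φ X) = symbolSeries P.series X []) (A : N) :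
    IsAlgebraic K (φ (.nonterminal A)) := by
  classical
  have := Fintype.ofFinite N
  let x : N → L := fun A => φ (.nonterminal A)
  let Q : N → MvPolynomial N K := fun A => ∑ β ∈ P.rules A, (β.map (symbolPolynomial c)).prod
  have hQ : ∀ A, MvPolynomial.aeval x (Q A) = x A := fun A => by
    simp only [Q, x, map_sum, aeval_prod_symbolPolynomial hterminal, heq A]
  have hjacobian : jacobianAt x Q = P.jacobian φ φ := by
    ext A B
    simp only [jacobianAt, jacobian, Matrix.of_apply, map_sum, Q, x,
      aeval_pderiv_prod_symbolPolynomial hterminal]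
  exact isAlgebraic_of_det_one_sub_jacobianAt_ne_zero hQ
    (hjacobian ▸ P.det_one_sub_jacobian_ne_zero χ hχ hχ) A

end RegularSystem

section SortedWordsOfSystem

variable {ι T N k : Type*} [LinearOrder ι] [Fintype ι] [Field k]

theorem sortedMatrix_formSeries_nil (F : N → List T → k) (x : ι → T) :
    sortedMatrix x (formSeries F []) = 1 :=
  transferMatrix_wordSingle_nil _ x

theorem sortedMatrix_formSeries_self (F : N → List T → k) (x : ι → T) (s : ι)
    (α : List (Symbol T N)) :
    sortedMatrix x (formSeries F α) s s =
      (α.map fun X => sortedMatrix x (symbolSeries F X) s s).prod := by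
  induction α with
  | nil => rw [sortedMatrix_formSeries_nil, Matrix.one_apply_eq, List.map_nil, List.prod_nil]
  | cons X α ih =>
    rw [formSeries, sortedMatrix_wordConv_self, ih, List.map_cons, List.prod_cons]

theorem sortedMatrix_formSeries_mem {F : N → List T → k} {x : ι → T}
    {A : Subalgebra k (MvPowerSeries ι k)} {s t : ι}
    (h : ∀ u v, s ≤ u → v ≤ t → ∀ X, sortedMatrix x (symbolSeries F X) u v ∈ A)
    (α : List (Symbol T N)) {u : ι} (hu : s ≤ u) : sortedMatrix x (formSeries F α) u t ∈ A := by
  induction α generalizing u with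
  | nil =>
    rw [sortedMatrix_formSeries_nil, Matrix.one_apply]
    split_ifs
    exacts [A.one_mem, A.zero_mem]
  | cons X α ih =>
    rw [formSeries, sortedMatrix_wordConv_apply]
    refine A.sum_mem fun v _ => ?_
    rcases lt_or_ge v u with hvu | huv
    · simp [sortedMatrix_apply_of_lt x _ hvu]
    rcases lt_or_ge t v with htv | hvt
    · simp [sortedMatrix_apply_of_lt x _ htv]
    exact A.mul_mem (h u v hu hvt X) (ih (hu.trans huv))

theorem sortedMatrix_wordConv_sub_mem {x : ι → T} {f g : List T → k}
    {A : Subalgebra k (MvPowerSeries ι k)} {s t : ι} (hst : s < t)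
    (hf : ∀ u < t, sortedMatrix x f s u ∈ A) (hg : ∀ u > s, sortedMatrix x g u t ∈ A) :
    sortedMatrix x (wordConv f g) s t - (sortedMatrix x f s s * sortedMatrix x g s t +
      sortedMatrix x f s t * sortedMatrix x g t t) ∈ A := by
  rw [sortedMatrix_wordConv_apply, ← Finset.sum_pair hst.ne
    (f := fun u => sortedMatrix x f s u * sortedMatrix x g u t), ← Finset.sum_sdiff_eq_sub
    (Finset.subset_univ _)]
  refine A.sum_mem fun u hu => ?_
  simp only [Finset.mem_sdiff, Finset.mem_univ, Finset.mem_insert, Finset.mem_singleton, true_and,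
    not_or] at hu
  rcases lt_or_gt_of_ne hu.1 with hus | hsu
  · simp [sortedMatrix_apply_of_lt x f hus]
  rcases lt_or_gt_of_ne hu.2 with hut | htu
  · exact A.mul_mem (hf u hut) (hg u hsu)
  · simp [sortedMatrix_apply_of_lt x g htu]

namespace RegularSystem

variable [Finite N] (P : RegularSystem T N k) (x : ι → T)

omit [Finite N] in
theorem sortedMatrix_series (A : N) :
    sortedMatrix x (P.series A) = ∑ β ∈ P.rules A, sortedMatrix x (formSeries P.series β) := by
  conv_lhs => rw [P.series_eq, sortedMatrix, transferMatrix_sum]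
  rfl

theorem isAlgebraic_sortedMatrix_self (s : ι) (A : N) :
    IsAlgebraic (MvPolynomial.supported k {s}) (sortedMatrix x (P.series A) s s) := by
  classical
  have : FaithfulSMul (MvPolynomial.supported k ({s} : Set ι)) (MvPowerSeries ι k) := by
    rw [faithfulSMul_iff_algebraMap_injective]
    exact fun p q h => Subtype.ext (MvPolynomial.coe_injective _ _ h)
  refine P.isAlgebraic_of_forall_eq_sum
    (φ := fun X => sortedMatrix x (symbolSeries P.series X) s s) MvPowerSeries.constantCoeff
    (fun t => if x s = t then ⟨MvPolynomial.X s, MvPolynomial.X_mem_supported.mpr rfl⟩ else 0)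
    (fun t => ?_) (fun A => ?_) (fun X => constantCoeff_transferMatrix _ x _ s) A
  · rw [symbolSeries, sortedMatrix_wordSingle_singleton, apply_ite (algebraMap _ _), map_zero]
    simp only [le_refl, true_and]
    congr 1
    exact (MvPolynomial.coe_X s).symm
  · simp only [symbolSeries, P.sortedMatrix_series, Matrix.sum_apply, sortedMatrix_formSeries_self]

theorem sortedMatrix_symbolSeries_self_mem (s : ι) (X : Symbol T N) :
    sortedMatrix x (symbolSeries P.series X) s s ∈ univariateAlgebraic k s := by
  rcases X with t | A
  · exact sortedMatrix_wordSingle_mem x t (X_mem_univariateAlgebraic k s)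
  · exact ⟨sortedMatrix_self_mem_range x _ s, P.isAlgebraic_sortedMatrix_self x s A⟩

omit [Fintype ι] [LinearOrder ι] in
theorem mem_separatedAlgebraic_of_forall_cons_sub_mem {i j : ι}
    {φ ψ μ : Symbol T N → MvPowerSeries ι k} {v : List (Symbol T N) → MvPowerSeries ι k}
    (hφ : ∀ X, φ X ∈ univariateAlgebraic k i) (hψ : ∀ X, ψ X ∈ univariateAlgebraic k j)
    (hφ' : ∀ X, MvPowerSeries.constantCoeff (φ X) = symbolSeries P.series X [])
    (hψ' : ∀ X, MvPowerSeries.constantCoeff (ψ X) = symbolSeries P.series X [])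
    (hnil : v [] ∈ separatedAlgebraic ι k)
    (hterminal : ∀ t, μ (.terminal t) ∈ separatedAlgebraic ι k)
    (hcons : ∀ X α, v (X :: α) - (φ X * v α + μ X * (α.map ψ).prod) ∈ separatedAlgebraic ι k)
    (heq : ∀ A, μ (.nonterminal A) = ∑ β ∈ P.rules A, v β) (A : N) :
    μ (.nonterminal A) ∈ separatedAlgebraic ι k := by
  classical
  have := Fintype.ofFinite N
  let S : Subalgebra k (MvPowerSeries ι k) := univariateAlgebraic k i ⊔ univariateAlgebraic k j
  have hS : S ≤ separatedAlgebraic ι k := sup_le (univariateAlgebraic_le_separatedAlgebraic i)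
    (univariateAlgebraic_le_separatedAlgebraic j)
  let V : Submodule S (MvPowerSeries ι k) :=
    { (separatedAlgebraic ι k).toSubring.toAddSubgroup with
      smul_mem' := fun e _ hf => mul_mem (hS e.2) hf }
  let φS : Symbol T N → S := fun X => ⟨φ X, Algebra.mem_sup_left (hφ X)⟩
  let ψS : Symbol T N → S := fun X => ⟨ψ X, Algebra.mem_sup_right (hψ X)⟩
  have hdet : ((1 - P.jacobian φS ψS).det : MvPowerSeries ι k) ≠ 0 := fun h =>
    P.det_one_sub_jacobian_ne_zero (MvPowerSeries.constantCoeff.comp S.val.toRingHom) hφ' hψ'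
      (Subtype.ext h)
  refine mem_separatedAlgebraic_of_mul_mem (1 - P.jacobian φS ψS).det.2 hdet ?_
  refine P.det_one_sub_jacobian_smul_mem V hnil hterminal (fun X α => ?_) heq A
  have hprod : ((α.map ψS).prod : MvPowerSeries ι k) = (α.map ψ).prod := by
    rw [← S.coe_val, map_list_prod, List.map_map]
    rfl
  rw [Subalgebra.smul_def, Subalgebra.smul_def, hprod, smul_eq_mul, smul_eq_mul,
    mul_comm _ (μ X)]
  exact hcons X α

theorem sortedMatrix_symbolSeries_mem_of_lt {s t : ι} (hst : s < t)
    (hleft : ∀ u, ∀ v < t, ∀ X, sortedMatrix x (symbolSeries P.series X) u v ∈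
      separatedAlgebraic ι k)
    (hright : ∀ u > s, ∀ X, sortedMatrix x (symbolSeries P.series X) u t ∈
      separatedAlgebraic ι k) (X : Symbol T N) :
    sortedMatrix x (symbolSeries P.series X) s t ∈ separatedAlgebraic ι k := by
  have hterminal : ∀ a, sortedMatrix x (wordSingle k [a]) s t ∈ separatedAlgebraic ι k := fun a =>
    sortedMatrix_wordSingle_mem x a
      (univariateAlgebraic_le_separatedAlgebraic t (X_mem_univariateAlgebraic k t))
  have hform : ∀ u > s, ∀ α, sortedMatrix x (formSeries P.series α) u t ∈ separatedAlgebraic ι k :=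
    fun u hsu α => sortedMatrix_formSeries_mem (s := u) (fun u' v huu' hvt X =>
      hvt.lt_or_eq.elim (fun hvt => hleft u' v hvt X)
        fun hvt => hvt ▸ hright u' (hsu.trans_le huu') X) α le_rfl
  rcases X with a | A
  · exact hterminal a
  refine P.mem_separatedAlgebraic_of_forall_cons_sub_mem
    (μ := fun X => sortedMatrix x (symbolSeries P.series X) s t)
    (v := fun α => sortedMatrix x (formSeries P.series α) s t)
    (P.sortedMatrix_symbolSeries_self_mem x s) (P.sortedMatrix_symbolSeries_self_mem x t)
    (fun X => constantCoeff_transferMatrix _ x _ s) (fun X => constantCoeff_transferMatrix _ x _ t)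
    ?_ hterminal (fun X α => ?_) (fun A => ?_) A
  · simp [sortedMatrix_formSeries_nil, hst.ne]
  · rw [← sortedMatrix_formSeries_self]
    exact sortedMatrix_wordConv_sub_mem hst (fun u hu => hleft s u hu X) (fun u hu => hform u hu α)
  · simp only [symbolSeries, P.sortedMatrix_series, Matrix.sum_apply]

theorem sortedMatrix_symbolSeries_mem (s t : ι) (X : Symbol T N) :
    sortedMatrix x (symbolSeries P.series X) s t ∈ separatedAlgebraic ι k := by
  induction t using WellFoundedLT.induction generalizing s X with | _ t hleft
  induction s using WellFoundedGT.induction generalizing X with | _ s hright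
  rcases lt_trichotomy s t with hst | rfl | hts
  · exact P.sortedMatrix_symbolSeries_mem_of_lt x hst (fun u v hv => hleft v hv u) hright X
  · exact univariateAlgebraic_le_separatedAlgebraic s
      (P.sortedMatrix_symbolSeries_self_mem x s X)
  · rw [sortedMatrix_apply_of_lt x _ hts]
    exact zero_mem _

end RegularSystem

end SortedWordsOfSystem

/-! ### Parse trees -/

namespace ParseForest

variable {T : Type*} {g : ContextFreeGrammar T} {α β : List (Symbol T g.NT)}

/-- The number of applications of rules in a sequence of parse trees. -/
def size : {α : List (Symbol T g.NT)} → ParseForest g α → ℕ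
  | _, .nil => 0
  | _, .leaf _ rest => rest.size
  | _, .node _ _ _ children rest => children.size + rest.size + 1

/-- The concatenation of two sequences of parse trees. -/
def append : {α : List (Symbol T g.NT)} → ParseForest g α → ParseForest g β → ParseForest g (α ++ β)
  | _, .nil, G => G
  | _, .leaf t rest, G => .leaf t (rest.append G)
  | _, .node A δ mem children rest, G => .node A δ mem children (rest.append G)

theorem yield_append (F : ParseForest g α) (G : ParseForest g β) :
    (F.append G).yield = F.yield ++ G.yield := by
  induction F with
  | nil => rfl
  | leaf _ _ ih => simp only [append, yield, ih, List.cons_append]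
  | node A δ mem children rest _ ih => simp only [append, yield, ih, List.append_assoc]

theorem size_append (F : ParseForest g α) (G : ParseForest g β) :
    (F.append G).size = F.size + G.size := by
  induction F with
  | nil => exact (Nat.zero_add _).symm
  | leaf _ _ ih => exact ih
  | node A δ mem children rest _ ih =>
    simp only [append, size, ih]
    ring

instance : Unique (ParseForest g []) where
  default := .nil
  uniq F := by cases F; rfl

instance (t : T) : Unique (ParseForest g [.terminal t]) where
  default := .leaf t .nil
  uniq F := by cases F with | leaf _ rest => cases rest; rfl

/-- A nonempty sequence of parse trees consists of its first tree and of the remaining trees. -/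
def consEquiv (X : Symbol T g.NT) (α : List (Symbol T g.NT)) :
    ParseForest g [X] × ParseForest g α ≃ ParseForest g (X :: α) where
  toFun p := p.1.append p.2
  invFun
    | .leaf t rest => (.leaf t .nil, rest)
    | .node A δ mem children rest => (.node A δ mem children .nil, rest)
  left_inv := by
    rintro ⟨F, G⟩
    cases F <;> rename_i rest <;> cases rest <;> rfl
  right_inv F := by cases F <;> rfl

theorem yield_consEquiv {X : Symbol T g.NT} (p : ParseForest g [X] × ParseForest g α) :
    (consEquiv X α p).yield = p.1.yield ++ p.2.yield :=
  yield_append p.1 p.2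

/-- The sequences of parse trees with roots `α` and with a given yield. -/
def withYield (g : ContextFreeGrammar T) (α : List (Symbol T g.NT)) (w : List T) :
    Set (ParseForest g α) :=
  {F | F.yield = w}

theorem ncard_withYield_of_unique (R : Type*) [CommRing R] [Unique (ParseForest g α)]
    (w : List T) : ((withYield g α w).ncard : R) =
      wordSingle R (default : ParseForest g α).yield w := by
  by_cases hw : (default : ParseForest g α).yield = w
  · have : withYield g α w = {default} :=
      (Set.eq_singleton_iff_unique_mem).mpr ⟨hw, fun F _ => Unique.eq_default F⟩
    simp [this, wordSingle, hw]
  · have : withYield g α w = ∅ :=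
      Set.eq_empty_of_forall_notMem fun F hF => hw (Unique.eq_default F ▸ hF)
    simp [this, wordSingle, Ne.symm hw]

/-- A nonempty sequence of parse trees with yield `w` consists of a first tree with yield `w.take i`
and of further trees with yield `w.drop i`, for a unique position `i`. -/
noncomputable def withYieldConsEquiv (X : Symbol T g.NT) (α : List (Symbol T g.NT)) (w : List T) :
    (Σ i : Fin (w.length + 1), withYield g [X] (w.take i) × withYield g α (w.drop i)) ≃
      withYield g (X :: α) w :=
  Equiv.ofBijective
    (fun p => ⟨consEquiv X α (p.2.1.1, p.2.2.1), (yield_consEquiv _).trans <| by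
      rw [p.2.1.2.out, p.2.2.2.out, List.take_append_drop]⟩) <| by
    constructor
    · rintro ⟨i, ⟨F, hF⟩, ⟨G, hG⟩⟩ ⟨i', ⟨F', hF'⟩, ⟨G', hG'⟩⟩ h
      obtain ⟨rfl, rfl⟩ := Prod.mk.inj ((consEquiv X α).injective (Subtype.ext_iff.mp h))
      have hlength := congrArg List.length (hF.out.symm.trans hF'.out)
      simp only [List.length_take] at hlength
      obtain rfl : i = i' := by omega
      rfl
    · rintro ⟨H, hH⟩
      obtain ⟨⟨F, G⟩, rfl⟩ := (consEquiv X α).surjective H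
      obtain rfl : F.yield ++ G.yield = w := (yield_consEquiv (F, G)).symm.trans hH
      exact ⟨⟨⟨F.yield.length, by rw [List.length_append]; omega⟩,
        ⟨F, List.take_left.symm⟩, ⟨G, List.drop_left.symm⟩⟩, rfl⟩

theorem finite_withYield_cons {X : Symbol T g.NT} (hX : ∀ w, (withYield g [X] w).Finite)
    (hα : ∀ w, (withYield g α w).Finite) (w : List T) : (withYield g (X :: α) w).Finite := by
  have := fun w => (hX w).to_subtype
  have := fun w => (hα w).to_subtype
  exact Set.finite_coe_iff.mp (Finite.of_equiv _ (withYieldConsEquiv X α w))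

theorem ncard_withYield_cons (R : Type*) [CommRing R] {X : Symbol T g.NT}
    (hX : ∀ w, (withYield g [X] w).Finite) (hα : ∀ w, (withYield g α w).Finite) (w : List T) :
    ((withYield g (X :: α) w).ncard : R) =
      wordConv (fun v => ((withYield g [X] v).ncard : R))
        (fun v => ((withYield g α v).ncard : R)) w := by
  have := fun w => (hX w).to_subtype
  have := fun w => (hα w).to_subtype
  rw [← Nat.card_coe_set_eq, ← Nat.card_congr (withYieldConsEquiv X α w), Nat.card_sigma]
  simp only [Nat.card_prod, Nat.card_coe_set_eq, Nat.cast_sum, Nat.cast_mul]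
  rw [wordConv, Finset.sum_range]

theorem finite_withYield_of_injective {f : ParseForest g α → ParseForest g β}
    (hf : Function.Injective f) {u : List T → List T} (hu : ∀ F, (f F).yield = u F.yield)
    (hβ : ∀ w, (withYield g β w).Finite) (w : List T) : (withYield g α w).Finite :=
  ((hβ (u w)).preimage hf.injOn).subset fun F hF => (hu F).trans (congrArg u hF)

/-- The sentential forms from which some word can be derived, but every word only in finitely many
ways. -/
def IsFinitary (g : ContextFreeGrammar T) (α : List (Symbol T g.NT)) : Prop :=
  (∀ w, (withYield g α w).Finite) ∧ Nonempty (ParseForest g α)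

theorem isFinitary_of_unique [Unique (ParseForest g α)] : IsFinitary g α :=
  ⟨fun _ => Set.toFinite _, inferInstance⟩

theorem isFinitary_cons {X : Symbol T g.NT} :
    IsFinitary g (X :: α) ↔ IsFinitary g [X] ∧ IsFinitary g α := by
  constructor
  · rintro ⟨hfin, ⟨H⟩⟩
    obtain ⟨⟨F, G⟩, rfl⟩ := (consEquiv X α).surjective H
    refine ⟨⟨?_, ⟨F⟩⟩, ⟨?_, ⟨G⟩⟩⟩
    · exact finite_withYield_of_injective
        ((consEquiv X α).injective.comp (Prod.mk_left_injective G))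
        (u := (· ++ G.yield)) (fun F => yield_append F G) hfin
    · exact finite_withYield_of_injective
        ((consEquiv X α).injective.comp (Prod.mk_right_injective F))
        (u := (F.yield ++ ·)) (fun G => yield_append F G) hfin
  · rintro ⟨⟨hX, ⟨F⟩⟩, ⟨hα, ⟨G⟩⟩⟩
    exact ⟨finite_withYield_cons hX hα, ⟨consEquiv X α (F, G)⟩⟩

theorem isFinitary_iff_forall_mem : IsFinitary g α ↔ ∀ X ∈ α, IsFinitary g [X] := by
  induction α with
  | nil => simp [isFinitary_of_unique]
  | cons X α ih => rw [isFinitary_cons, ih, List.forall_mem_cons]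

theorem isFinitary_children {A : g.NT} (hA : IsFinitary g [.nonterminal A])
    (mem : ContextFreeRule.mk A β ∈ g.rules) (F : ParseForest g β) : IsFinitary g β := by
  refine ⟨finite_withYield_of_injective (f := fun F => .node A β mem F .nil) (u := id)
    (fun F G h => ?_) (fun F => List.append_nil _) hA.1, ⟨F⟩⟩
  injection h

/-- The nonterminals that have a parse tree, but only finitely many for each word. -/
def finitaryNonterminals (g : ContextFreeGrammar T) : Set g.NT :=
  {A | IsFinitary g [.nonterminal A]}

theorem finite_finitaryNonterminals (g : ContextFreeGrammar T) :
    (finitaryNonterminals g).Finite := by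
  refine (g.rules.finite_toSet.image ContextFreeRule.input).subset ?_
  rintro A ⟨-, ⟨F⟩⟩
  cases F with
  | node _ β mem _ _ => exact ⟨_, mem, rfl⟩

noncomputable instance : Fintype (finitaryNonterminals g) :=
  (finite_finitaryNonterminals g).fintype

/-- The inclusion of the symbols with finitary nonterminals into all symbols. -/
def finitarySymbol : Symbol T (finitaryNonterminals g) → Symbol T g.NT
  | .terminal t => .terminal t
  | .nonterminal A => .nonterminal A

theorem finitarySymbol_injective : Function.Injective (finitarySymbol (g := g)) := by
  rintro (t | A) (t' | A') h <;> simp_all [finitarySymbol, Subtype.ext_iff]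

theorem isFinitary_iff_mem_range :
    IsFinitary g α ↔ α ∈ Set.range (List.map (finitarySymbol (g := g))) := by
  rw [isFinitary_iff_forall_mem, Set.range_list_map]
  refine forall₂_congr fun X _ => ⟨fun hX => ?_, ?_⟩
  · cases X with
    | terminal t => exact ⟨.terminal t, rfl⟩
    | nonterminal A => exact ⟨.nonterminal ⟨A, hX⟩, rfl⟩
  · rintro ⟨t | A, rfl⟩
    exacts [isFinitary_of_unique (α := [.terminal t]), A.2]

theorem isFinitary_map_finitarySymbol (β : List (Symbol T (finitaryNonterminals g))) :
    IsFinitary g (β.map finitarySymbol) :=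
  isFinitary_iff_mem_range.mpr ⟨β, rfl⟩

/-- The number of parse trees of a word with a given root. -/
noncomputable def treeSeries (g : ContextFreeGrammar T) (R : Type*) [CommRing R]
    (A : finitaryNonterminals g) (w : List T) : R :=
  (withYield g [.nonterminal A.1] w).ncard

theorem symbolSeries_treeSeries (R : Type*) [CommRing R]
    (X : Symbol T (finitaryNonterminals g)) (w : List T) :
    symbolSeries (treeSeries g R) X w = (withYield g [finitarySymbol X] w).ncard := by
  cases X with
  | terminal t => exact (ncard_withYield_of_unique (g := g) (α := [.terminal t]) R w).symm
  | nonterminal A => rfl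

theorem formSeries_treeSeries (R : Type*) [CommRing R]
    (β : List (Symbol T (finitaryNonterminals g))) (w : List T) :
    formSeries (treeSeries g R) β w = (withYield g (β.map finitarySymbol) w).ncard := by
  induction β generalizing w with
  | nil => exact (ncard_withYield_of_unique (g := g) (α := []) R w).symm
  | cons X β ih =>
    rw [formSeries, funext ih, funext (symbolSeries_treeSeries R X)]
    exact (ncard_withYield_cons R (isFinitary_map_finitarySymbol [X]).1
      (isFinitary_map_finitarySymbol β).1 w).symm

/-- The right-hand sides of the rules for a nonterminal in which all nonterminals are finitary. -/
noncomputable def finitaryRules (A : finitaryNonterminals g) :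
    Finset (List (Symbol T (finitaryNonterminals g))) :=
  g.rules.preimage (fun β => ⟨A.1, β.map finitarySymbol⟩) fun _ _ _ _ h =>
    finitarySymbol_injective.list_map (ContextFreeRule.mk.inj h).2

theorem mem_finitaryRules {A : finitaryNonterminals g}
    {β : List (Symbol T (finitaryNonterminals g))} :
    β ∈ finitaryRules A ↔ ContextFreeRule.mk A.1 (β.map finitarySymbol) ∈ g.rules :=
  Finset.mem_preimage

/-- A parse tree is determined by the rule that is applied to its root and by the subtrees. -/
noncomputable def withYieldNodeEquiv (A : finitaryNonterminals g) (w : List T) :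
    (Σ β : finitaryRules A, withYield g (β.1.map finitarySymbol) w) ≃
      withYield g [.nonterminal A.1] w :=
  Equiv.ofBijective (fun p => ⟨.node A.1 _ (mem_finitaryRules.mp p.1.2) p.2.1 .nil,
      (List.append_nil _).trans p.2.2⟩) <| by
    constructor
    · rintro ⟨⟨β, hβ⟩, ⟨F, hF⟩⟩ ⟨⟨γ, hγ⟩, ⟨G, hG⟩⟩ h
      obtain ⟨hβγ, hFG, -⟩ := ParseForest.node.inj (Subtype.ext_iff.mp h)
      obtain rfl : β = γ := finitarySymbol_injective.list_map hβγ
      obtain rfl := eq_of_heq hFG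
      rfl
    · rintro ⟨F, hF⟩
      cases F with
      | node _ β mem F rest =>
        obtain ⟨γ, rfl⟩ := isFinitary_iff_mem_range.mp (isFinitary_children A.2 mem F)
        cases rest
        exact ⟨⟨⟨γ, mem_finitaryRules.mpr mem⟩, ⟨F, (List.append_nil _).symm.trans hF⟩⟩, rfl⟩

theorem treeSeries_eq (R : Type*) [CommRing R] (A : finitaryNonterminals g) :
    treeSeries g R A = ∑ β ∈ finitaryRules A, formSeries (treeSeries g R) β := by
  ext w
  have := fun β : finitaryRules A => ((isFinitary_map_finitarySymbol β.1).1 w).to_subtype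
  simp only [Finset.sum_apply, formSeries_treeSeries]
  rw [treeSeries, ← Nat.card_coe_set_eq, ← Nat.card_congr (withYieldNodeEquiv A w),
    Nat.card_sigma, Nat.cast_sum]
  simp only [Nat.card_coe_set_eq]
  exact Finset.sum_coe_sort (finitaryRules A)
    fun β => ((withYield g (β.map finitarySymbol) w).ncard : R)

theorem exists_size_lt {A B : finitaryNonterminals g}
    {α γ : List (Symbol T (finitaryNonterminals g))}
    (h : α ++ .nonterminal B :: γ ∈ finitaryRules A)
    (hα : (withYield g (α.map finitarySymbol) []).Nonempty)
    (hγ : (withYield g (γ.map finitarySymbol) []).Nonempty) {w : List T}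
    {F : ParseForest g [.nonterminal B.1]} (hF : F ∈ withYield g _ w) :
    ∃ G ∈ withYield g [.nonterminal A.1] w, F.size < G.size := by
  obtain ⟨Fα, hFα⟩ := hα
  obtain ⟨Fγ, hFγ⟩ := hγ
  rw [mem_finitaryRules, List.map_append] at h
  change ContextFreeRule.mk A.1 (_ ++ ([.nonterminal B.1] ++ _)) ∈ g.rules at h
  refine ⟨.node A.1 _ h (Fα.append (F.append Fγ)) .nil, ?_, ?_⟩
  · refine (List.append_nil _).trans ?_
    rw [yield_append, yield_append, hFα.out, hFγ.out, hF.out, List.append_nil, List.nil_append]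
  · change F.size < (Fα.append (F.append Fγ)).size + 0 + 1
    rw [size_append, size_append]
    omega

/-- The greatest size of a parse tree of a word with a given root. -/
noncomputable def maxSize (A : finitaryNonterminals g) (w : List T) : ℕ :=
  (A.2.1 w).toFinset.sup size

theorem size_le_maxSize {A : finitaryNonterminals g} {w : List T}
    {F : ParseForest g [.nonterminal A.1]} (hF : F ∈ withYield g _ w) : F.size ≤ maxSize A w :=
  Finset.le_sup (f := size) ((A.2.1 w).mem_toFinset.mpr hF)

theorem maxSize_lt {A B : finitaryNonterminals g} {w : List T}
    (hw : (withYield g [.nonterminal B.1] w).Nonempty)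
    (h : ∀ F ∈ withYield g [.nonterminal B.1] w,
      ∃ G ∈ withYield g [.nonterminal A.1] w, F.size < G.size) : maxSize B w < maxSize A w := by
  have hlt : ∀ F ∈ withYield g [.nonterminal B.1] w, F.size < maxSize A w := fun F hF =>
    let ⟨_, hG, hFG⟩ := h F hF
    hFG.trans_le (size_le_maxSize hG)
  obtain ⟨F, hF⟩ := hw
  exact (Finset.sup_lt_iff (pos_of_gt (hlt F hF))).mpr fun F hF =>
    hlt F ((B.2.1 w).mem_toFinset.mp hF)

theorem maxSize_le {A B : finitaryNonterminals g} {w : List T}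
    (h : ∀ F ∈ withYield g [.nonterminal B.1] w,
      ∃ G ∈ withYield g [.nonterminal A.1] w, F.size < G.size) : maxSize B w ≤ maxSize A w :=
  Finset.sup_le fun F hF =>
    let ⟨_, hG, hFG⟩ := h F ((B.2.1 w).mem_toFinset.mp hF)
    hFG.le.trans (size_le_maxSize hG)

/-- The sum of the greatest sizes of the parse trees with root `A`, over one word for each
nonterminal `C` that is the yield of some parse tree with root `C`. -/
noncomputable def treeRank (A : finitaryNonterminals g) : ℕ :=
  ∑ C : finitaryNonterminals g, maxSize A C.2.2.some.yield

theorem treeRank_lt {A B : finitaryNonterminals g}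
    {α γ : List (Symbol T (finitaryNonterminals g))}
    (h : α ++ .nonterminal B :: γ ∈ finitaryRules A)
    (hα : (withYield g (α.map finitarySymbol) []).Nonempty)
    (hγ : (withYield g (γ.map finitarySymbol) []).Nonempty) : treeRank B < treeRank A :=
  Finset.sum_lt_sum (fun _ _ => maxSize_le fun _ => exists_size_lt h hα hγ)
    ⟨B, Finset.mem_univ B, maxSize_lt ⟨B.2.2.some, rfl⟩ fun _ => exists_size_lt h hα hγ⟩

theorem withYield_nonempty_of_formSeries_ne_zero {R : Type*} [CommRing R]
    {β : List (Symbol T (finitaryNonterminals g))} {w : List T}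
    (h : formSeries (treeSeries g R) β w ≠ 0) :
    (withYield g (β.map finitarySymbol) w).Nonempty :=
  Set.nonempty_of_ncard_ne_zero fun h0 => h <| by
    rw [formSeries_treeSeries, h0, Nat.cast_zero]

/-- The system of equations for the numbers of parse trees, given by the rules of the grammar. -/
noncomputable def regularSystem (g : ContextFreeGrammar T) (R : Type*) [CommRing R] :
    RegularSystem T (finitaryNonterminals g) R where
  rules := finitaryRules
  series := treeSeries g R
  series_eq := treeSeries_eq R
  rank := treeRank
  rank_lt _ _ _ _ h hα hγ := treeRank_lt h (withYield_nonempty_of_formSeries_ne_zero hα)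
    (withYield_nonempty_of_formSeries_ne_zero hγ)

end ParseForest

/-! ### The diagonal series has infinite rank -/

section SeparatedSeries

variable {σ k : Type*} [CommRing k]

/-- The finite sums of products of power series in one variable each. -/
noncomputable def separatedSeries (σ k : Type*) [CommRing k] : Subalgebra k (MvPowerSeries σ k) :=
  ⨆ i, (PowerSeries.toMvPowerSeries (R := k) i).range

/-- The power series that do not involve the variable `i`. -/
def seriesFreeOf (k : Type*) [CommRing k] (i : σ) : Subalgebra k (MvPowerSeries σ k) where
  carrier := {f | ∀ m, m i ≠ 0 → MvPowerSeries.coeff m f = 0}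
  mul_mem' {f g} hf hg m hm := by
    classical
    rw [MvPowerSeries.coeff_mul]
    refine Finset.sum_eq_zero fun p hp => ?_
    rw [← Finset.HasAntidiagonal.mem_antidiagonal.mp hp, Finsupp.add_apply] at hm
    rcases (by omega : p.1 i ≠ 0 ∨ p.2 i ≠ 0) with h | h
    · rw [hf _ h, zero_mul]
    · rw [hg _ h, mul_zero]
  add_mem' hf hg m hm := by rw [map_add, hf m hm, hg m hm, add_zero]
  algebraMap_mem' c m hm := by
    classical
    rw [MvPowerSeries.algebraMap_apply, MvPowerSeries.coeff_C, if_neg]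
    rintro rfl
    exact hm rfl

theorem range_toMvPowerSeries_le_seriesFreeOf {i j : σ} (hij : j ≠ i) :
    (PowerSeries.toMvPowerSeries (R := k) j).range ≤ seriesFreeOf k i := by
  classical
  rintro _ ⟨f, rfl⟩ m hm
  refine (coeff_toMvPowerSeries j f m).trans (if_neg fun h => hm ?_)
  rw [h, Finsupp.single_eq_of_ne hij.symm]

theorem separatedSeries_le (i : σ) :
    separatedSeries σ k ≤ seriesFreeOf k i ⊔ (PowerSeries.toMvPowerSeries (R := k) i).range := by
  refine iSup_le fun j => ?_
  rcases eq_or_ne j i with rfl | hij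
  exacts [le_sup_right, (range_toMvPowerSeries_le_seriesFreeOf hij).trans le_sup_left]

theorem coeff_mul_toMvPowerSeries {i : σ} {f : MvPowerSeries σ k} (hf : f ∈ seriesFreeOf k i)
    (g : PowerSeries k) (m : σ →₀ ℕ) :
    MvPowerSeries.coeff m (f * g.toMvPowerSeries i) =
      MvPowerSeries.coeff (m.erase i) f * g.coeff (m i) := by
  classical
  rw [MvPowerSeries.coeff_mul, Finset.sum_eq_single (m.erase i, Finsupp.single i (m i))]
  · simp [coeff_toMvPowerSeries]
  · rintro ⟨u, v⟩ huv hne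
    obtain rfl : u + v = m := Finset.HasAntidiagonal.mem_antidiagonal.mp huv
    by_cases hu : u i = 0
    · rw [coeff_toMvPowerSeries, if_neg, mul_zero]
      intro hv
      change v = Finsupp.single i (v i) at hv
      refine hne (Prod.ext ?_ ?_)
      · change u = (u + v).erase i
        rw [Finsupp.erase_add, hv, Finsupp.erase_single, add_zero, Finsupp.erase_of_notMem_support
          (Finsupp.notMem_support_iff.mpr hu)]
      · change v = Finsupp.single i ((u + v) i)
        rwa [Finsupp.add_apply, hu, zero_add]
    · rw [hf u hu, zero_mul]
  · exact fun h =>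
      absurd (Finset.HasAntidiagonal.mem_antidiagonal.mpr (Finsupp.erase_add_single i m)) h

theorem exists_coeff_eq_sum_of_mem_separatedSeries {f : MvPowerSeries σ k}
    (hf : f ∈ separatedSeries σ k) (i : σ) :
    ∃ (n : ℕ) (g : Fin n → MvPowerSeries σ k) (h : Fin n → PowerSeries k), ∀ m,
      MvPowerSeries.coeff m f =
        ∑ j, MvPowerSeries.coeff (m.erase i) (g j) * (h j).coeff (m i) := by
  have hf' := separatedSeries_le i hf
  rw [← Subalgebra.mem_toSubmodule, ← Subalgebra.mul_toSubmodule, Submodule.mul_eq_span_mul_set,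
    Submodule.mem_span_set'] at hf'
  obtain ⟨n, c, s, rfl⟩ := hf'
  choose g hg h' hh' hs using fun j => (s j).2
  choose h hh using hh'
  refine ⟨n, fun j => c j • g j, h, fun m => ?_⟩
  rw [map_sum]
  refine Finset.sum_congr rfl fun j _ => ?_
  rw [← hs, ← hh]
  change MvPowerSeries.coeff m (c j • (g j * (h j).toMvPowerSeries i)) = _
  rw [← smul_mul_assoc]
  exact coeff_mul_toMvPowerSeries (Subalgebra.smul_mem _ (hg j) (c j)) (h j) m

end SeparatedSeries

section Diagonal

variable {k : Type*} [CommRing k]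

/-- The power series `∑ₙ (abc)ⁿ`. -/
def diagonalSeries (k : Type*) [CommRing k] : MvPowerSeries (Fin 3) k :=
  fun m => if m 0 = m 1 ∧ m 1 = m 2 then 1 else 0

theorem coeff_diagonalSeries (m : Fin 3 →₀ ℕ) :
    MvPowerSeries.coeff m (diagonalSeries k) = if m 0 = m 1 ∧ m 1 = m 2 then 1 else 0 :=
  rfl

theorem X_mul_X_mul_X_eq_monomial (k : Type*) [CommRing k] :
    (MvPowerSeries.X 0 * MvPowerSeries.X 1 * MvPowerSeries.X 2 : MvPowerSeries (Fin 3) k) =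
      MvPowerSeries.monomial (Finsupp.equivFunOnFinite.symm 1) 1 := by
  rw [MvPowerSeries.X, MvPowerSeries.X, MvPowerSeries.X, MvPowerSeries.monomial_mul_monomial,
    MvPowerSeries.monomial_mul_monomial]
  have h : (Finsupp.single 0 1 + Finsupp.single 1 1 + Finsupp.single 2 1 : Fin 3 →₀ ℕ) =
      Finsupp.equivFunOnFinite.symm 1 := by
    ext i
    fin_cases i <;> simp
  rw [h, mul_one, mul_one]

theorem one_sub_mul_diagonalSeries (k : Type*) [CommRing k] :
    (1 - MvPowerSeries.X 0 * MvPowerSeries.X 1 * MvPowerSeries.X 2) * diagonalSeries k = 1 := by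
  ext m
  rw [X_mul_X_mul_X_eq_monomial, sub_mul, one_mul, map_sub, MvPowerSeries.coeff_monomial_mul,
    MvPowerSeries.coeff_one, coeff_diagonalSeries, coeff_diagonalSeries]
  have hle : Finsupp.equivFunOnFinite.symm 1 ≤ m ↔ 1 ≤ m 0 ∧ 1 ≤ m 1 ∧ 1 ≤ m 2 := by
    simp [Finsupp.le_def, Fin.forall_fin_succ]
  have h0 : m = 0 ↔ m 0 = 0 ∧ m 1 = 0 ∧ m 2 = 0 := by
    simp [Finsupp.ext_iff, Fin.forall_fin_succ]
  simp only [hle, h0, Finsupp.coe_tsub, Pi.sub_apply, Finsupp.equivFunOnFinite_symm_apply_apply,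
    Pi.one_apply, one_mul]
  by_cases h : m 0 = m 1 ∧ m 1 = m 2
  · obtain ⟨h1, h2⟩ := h
    rcases Nat.eq_zero_or_pos (m 2) with h3 | h3
    · simp [h1, h2, h3]
    · simp [h1, h2, Nat.one_le_iff_ne_zero, h3.ne']
  · by_cases h' : 1 ≤ m 0 ∧ 1 ≤ m 1 ∧ 1 ≤ m 2
    · rw [if_neg h, if_pos h', if_neg (by omega), if_neg (by omega), sub_zero]
    · rw [if_neg h, if_neg h', if_neg (by omega), sub_zero]

/-- The class of an exponent vector modulo translations by `(1, 1, 1)`. -/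
def exponentClass (m : Fin 3 →₀ ℕ) : ℤ × ℤ := ((m 0 : ℤ) - m 2, (m 1 : ℤ) - m 2)

theorem eq_of_exponentClass_eq {m m' : Fin 3 →₀ ℕ} (h : exponentClass m = exponentClass m')
    {j : Fin 3} (hj : m j = m' j) : m = m' := by
  obtain ⟨h0, h1⟩ := Prod.mk.inj h
  ext i
  fin_cases i <;> fin_cases j <;> simp only [Fin.mk_zero, Fin.mk_one, Fin.reduceFinMk] at hj ⊢ <;>
    omega

/-- The reduction of polynomials modulo `1 - abc`, with the values `x`, `y`, `x⁻¹y⁻¹` of the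
variables in the Laurent polynomials in `x` and `y`. -/
noncomputable def reduceDiagonal (k : Type*) [CommRing k] :
    MvPolynomial (Fin 3) k →ₐ[k] AddMonoidAlgebra k (ℤ × ℤ) :=
  MvPolynomial.aeval ![AddMonoidAlgebra.single (1, 0) 1, AddMonoidAlgebra.single (0, 1) 1,
    AddMonoidAlgebra.single (-1, -1) 1]

theorem reduceDiagonal_monomial (m : Fin 3 →₀ ℕ) (c : k) :
    reduceDiagonal k (MvPolynomial.monomial m c) =
      AddMonoidAlgebra.single (exponentClass m) c := by
  rw [reduceDiagonal, MvPolynomial.aeval_monomial, Finsupp.prod_fintype _ _ (by simp),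
    Fin.prod_univ_three]
  simp only [Matrix.cons_val_zero, Matrix.cons_val_one, Matrix.cons_val,
    AddMonoidAlgebra.single_pow, AddMonoidAlgebra.single_mul_single, one_pow, mul_one,
    AddMonoidAlgebra.coe_algebraMap, Function.comp_apply, Algebra.algebraMap_self,
    RingHom.id_apply, zero_add]
  congr 1
  ext <;> simp [exponentClass] <;> ring

theorem coeff_reduceDiagonal (p : MvPolynomial (Fin 3) k) (z : ℤ × ℤ) :
    (reduceDiagonal k p).coeff z =
      ∑ m ∈ p.support, if exponentClass m = z then p.coeff m else 0 := by
  conv_lhs => rw [p.as_sum, map_sum]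
  simp only [reduceDiagonal_monomial, AddMonoidAlgebra.coeff_sum, AddMonoidAlgebra.coeff_single,
    Finsupp.finsetSum_apply, Finsupp.single_apply]

theorem reduceDiagonal_ne_zero_of_notMem_vars {p : MvPolynomial (Fin 3) k} (hp : p ≠ 0) {j : Fin 3}
    (hj : j ∉ p.vars) : reduceDiagonal k p ≠ 0 := by
  have hzero : ∀ m ∈ p.support, m j = 0 := fun m hm => by
    by_contra hmj
    exact hj ((MvPolynomial.mem_vars_iff_mem_support j).mpr
      ⟨m, hm, Finsupp.mem_support_iff.mpr hmj⟩)
  obtain ⟨m, hm⟩ := MvPolynomial.support_nonempty.mpr hp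
  intro h
  have hcoeff := coeff_reduceDiagonal p (exponentClass m)
  rw [h, Finset.sum_eq_single_of_mem m hm fun m' hm' hne => if_neg fun heq =>
    hne (eq_of_exponentClass_eq heq ((hzero m' hm').trans (hzero m hm).symm)), if_pos rfl] at hcoeff
  exact MvPolynomial.mem_support_iff.mp hm hcoeff.symm

theorem coeff_mul_diagonalSeries (p : MvPolynomial (Fin 3) k) {M : Fin 3 →₀ ℕ}
    (hM : ∀ m ∈ p.support, m ≤ M) :
    MvPowerSeries.coeff M ((p : MvPowerSeries (Fin 3) k) * diagonalSeries k) =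
      (reduceDiagonal k p).coeff (exponentClass M) := by
  have hsum : (p : MvPowerSeries (Fin 3) k) =
      ∑ m ∈ p.support, MvPowerSeries.monomial m (p.coeff m) := by
    conv_lhs => rw [p.as_sum]
    rw [← MvPolynomial.coeToMvPowerSeries.ringHom_apply, map_sum]
    simp
  rw [coeff_reduceDiagonal, hsum, Finset.sum_mul, map_sum]
  refine Finset.sum_congr rfl fun m hm => ?_
  have hle := hM m hm
  rw [MvPowerSeries.coeff_monomial_mul, if_pos hle, coeff_diagonalSeries]
  have hclass : ((M - m) 0 = (M - m) 1 ∧ (M - m) 1 = (M - m) 2) ↔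
      exponentClass m = exponentClass M := by
    have h0 := hle 0
    have h1 := hle 1
    have h2 := hle 2
    simp only [Finsupp.coe_tsub, Pi.sub_apply, exponentClass, Prod.mk.injEq]
    omega
  simp only [hclass, mul_ite, mul_one, mul_zero]

theorem exists_forall_le_exponentClass_eq (s : Finset (Fin 3 →₀ ℕ)) (m : Fin 3 →₀ ℕ) :
    ∃ M, (∀ m' ∈ s, m' ≤ M) ∧ exponentClass M = exponentClass m := by
  let D := s.sup id
  refine ⟨m + Finsupp.equivFunOnFinite.symm fun _ => D.degree, fun m' hm' i => ?_, ?_⟩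
  · have : m' i ≤ D i := Finset.le_sup (f := id) hm' i
    have := this.trans (Finsupp.le_degree i D)
    simp only [Finsupp.add_apply, Finsupp.equivFunOnFinite_symm_apply_apply]
    omega
  · simp [exponentClass]

/-- The class of `m` is an exponent of the Laurent polynomial `reduceDiagonal k p` with the greatest
first coordinate; hence its translates by `(s - t, s - t)` with `t < s` are not exponents of it. -/
theorem exists_forall_coeff_mul_diagonalSeries_ne_zero_iff {p : MvPolynomial (Fin 3) k}
    (hp : reduceDiagonal k p ≠ 0) :
    ∃ m : Fin 3 →₀ ℕ, ∀ s t : ℕ, t ≤ s → (MvPowerSeries.coeff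
      (m + Finsupp.single 0 s + Finsupp.single 1 s + Finsupp.single 2 t)
      ((p : MvPowerSeries (Fin 3) k) * diagonalSeries k) ≠ 0 ↔ s = t) := by
  have hsupp : (reduceDiagonal k p).coeff.support.Nonempty :=
    Finsupp.support_nonempty_iff.mpr fun h => hp (AddMonoidAlgebra.coeff_eq_zero.mp h)
  obtain ⟨z, hz, hmax⟩ := Finset.exists_max_image _ Prod.fst hsupp
  rw [Finsupp.mem_support_iff] at hz
  obtain ⟨m₀, -, hm₀⟩ := Finset.exists_ne_zero_of_sum_ne_zero (coeff_reduceDiagonal p z ▸ hz)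
  obtain ⟨m, hm, hclass⟩ := exists_forall_le_exponentClass_eq p.support m₀
  rw [(ite_ne_right_iff.mp hm₀).1] at hclass
  refine ⟨m, fun s t hts => ?_⟩
  have hle : ∀ m' ∈ p.support,
      m' ≤ m + Finsupp.single 0 s + Finsupp.single 1 s + Finsupp.single 2 t := fun m' hm' =>
    (hm m' hm').trans (by rw [add_assoc, add_assoc]; exact le_self_add)
  have htranslate : exponentClass
      (m + Finsupp.single 0 s + Finsupp.single 1 s + Finsupp.single 2 t) =
        (z.1 + (s - t), z.2 + (s - t)) := by
    rw [← hclass]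
    simp [exponentClass]
    constructor <;> ring
  rw [coeff_mul_diagonalSeries p hle, htranslate]
  constructor
  · intro h
    have := hmax _ (Finsupp.mem_support_iff.mpr h)
    simp only at this
    omega
  · rintro rfl
    simpa using hz

end Diagonal

section SeparatedFractions

variable {k : Type*} [Field k]

theorem card_le_card_of_isUpperTriangular_mul {m n : Type*} [Fintype m] [LinearOrder m] [Fintype n]
    {U : Matrix m n k} {V : Matrix n m k} (h : (U * V).BlockTriangular id)
    (hdiag : ∀ i, (U * V) i i ≠ 0) : Fintype.card m ≤ Fintype.card n := by
  classical
  have hdet : (U * V).det ≠ 0 := by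
    rw [Matrix.det_of_isUpperTriangular h]
    exact Finset.prod_ne_zero_iff.mpr fun i _ => hdiag i
  calc Fintype.card m = (U * V).rank :=
        (Matrix.rank_of_isUnit _ ((Matrix.isUnit_iff_isUnit_det _).mpr hdet.isUnit)).symm
    _ ≤ U.rank := Matrix.rank_mul_le_left U V
    _ ≤ Fintype.card n := Matrix.rank_le_card_width U

theorem mul_diagonalSeries_notMem_separatedSeries {p : MvPolynomial (Fin 3) k}
    (hp : reduceDiagonal k p ≠ 0) :
    (p : MvPowerSeries (Fin 3) k) * diagonalSeries k ∉ separatedSeries (Fin 3) k := by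
  intro hmem
  obtain ⟨n, g, h, hgh⟩ := exists_coeff_eq_sum_of_mem_separatedSeries hmem 2
  obtain ⟨m, hm⟩ := exists_forall_coeff_mul_diagonalSeries_ne_zero_iff hp
  let U : Matrix (Fin (n + 1)) (Fin n) k := Matrix.of fun s j => MvPowerSeries.coeff
    ((m + Finsupp.single 0 (s : ℕ) + Finsupp.single 1 (s : ℕ)).erase 2) (g j)
  let V : Matrix (Fin n) (Fin (n + 1)) k := Matrix.of fun j t => (h j).coeff (m 2 + t)
  have hUV : ∀ s t, (U * V) s t = MvPowerSeries.coeff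
      (m + Finsupp.single 0 (s : ℕ) + Finsupp.single 1 (s : ℕ) + Finsupp.single 2 (t : ℕ))
        ((p : MvPowerSeries (Fin 3) k) * diagonalSeries k) := fun s t => by
    rw [hgh, Matrix.mul_apply]
    simp [U, V, Finsupp.erase_add]
  have hcard := card_le_card_of_isUpperTriangular_mul (U := U) (V := V)
    (fun s t (hts : t < s) => ?_) fun s => ?_
  · simp at hcard
  · rw [hUV]
    by_contra hne
    exact hts.ne' (Fin.ext ((hm s t hts.le).mp hne))
  · rw [hUV]
    exact (hm s s le_rfl).mpr rfl

theorem reduceDiagonal_ne_zero_of_mem_bivariateProducts {p : MvPolynomial (Fin 3) k}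
    (hp : p ∈ bivariateProducts (Fin 3) k) : reduceDiagonal k p ≠ 0 := by
  have hle : bivariateProducts (Fin 3) k ≤
      (nonZeroDivisors (AddMonoidAlgebra k (ℤ × ℤ))).comap (reduceDiagonal k) := by
    refine Submonoid.closure_le.mpr ?_
    rintro q ⟨hq0, i, j, hq⟩
    have hthird : ∀ i j : Fin 3, ∃ l, ¬ (l = i ∨ l = j) := by decide
    obtain ⟨l, hl⟩ := hthird i j
    exact mem_nonZeroDivisors_of_ne_zero (reduceDiagonal_ne_zero_of_notMem_vars hq0
      fun hlq => hl (MvPolynomial.mem_supported.mp hq hlq))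
  exact nonZeroDivisors.ne_zero (hle hp)

theorem diagonalSeries_notMem_separatedAlgebraic :
    diagonalSeries k ∉ separatedAlgebraic (Fin 3) k :=
  fun h =>
    let ⟨_, hp, hmem⟩ := mem_separatedAlgebraic.mp h
    mul_diagonalSeries_notMem_separatedSeries (reduceDiagonal_ne_zero_of_mem_bivariateProducts hp)
      ((iSup_mono fun _ => inf_le_left : _ ≤ separatedSeries (Fin 3) k) hmem)

/-- The fractions whose numerators are finite sums of products of power series in one variable each
and whose denominators are products of nonzero polynomials in two variables each. -/
def separatedFractions (σ k : Type*) [Field k] : Set (FractionRing (MvPowerSeries σ k)) :=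
  {f | ∃ g ∈ separatedSeries σ k, ∃ p ∈ bivariateProducts σ k,
    f = algebraMap (MvPowerSeries σ k) _ g / algebraMap (MvPowerSeries σ k) _ p}

theorem inv_one_sub_notMem_separatedFractions :
    (algebraMap (MvPowerSeries (Fin 3) k) (FractionRing (MvPowerSeries (Fin 3) k))
      (1 - MvPowerSeries.X 0 * MvPowerSeries.X 1 * MvPowerSeries.X 2))⁻¹ ∉
        separatedFractions (Fin 3) k := by
  rintro ⟨g, hg, p, hp, h⟩
  have hreduce := reduceDiagonal_ne_zero_of_mem_bivariateProducts hp
  have hp0 : algebraMap _ (FractionRing (MvPowerSeries (Fin 3) k)) (p : MvPowerSeries (Fin 3) k) ≠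
      0 := by
    rw [ne_eq, FaithfulSMul.algebraMap_eq_zero_iff, MvPolynomial.coe_eq_zero_iff]
    rintro rfl
    exact hreduce (map_zero _)
  rw [inv_eq_of_mul_eq_one_right (b := algebraMap _ _ (diagonalSeries k))
    (by rw [← map_mul, one_sub_mul_diagonalSeries, map_one]), eq_div_iff hp0, ← map_mul] at h
  refine mul_diagonalSeries_notMem_separatedSeries hreduce ?_
  rwa [mul_comm, FaithfulSMul.algebraMap_injective _ _ h]

end SeparatedFractions

/-! ### Words with equal powers and grammars -/

section EqualPowers

theorem prod_map_enterMatrix_replicate_append {ι R : Type*} [LinearOrder ι] [Fintype ι]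
    [CommRing R] {s j : ι} (hsj : s ≤ j) (n : ℕ) (w : List ι) (t : ι) :
    ((List.replicate (n + 1) j ++ w).map (enterMatrix R)).prod s t =
      (w.map (enterMatrix R)).prod j t := by
  induction n generalizing s with
  | zero => exact (prod_map_enterMatrix_cons j w s t).trans (if_pos hsj)
  | succ n ih =>
    rw [List.replicate_succ, List.cons_append, prod_map_enterMatrix_cons, if_pos hsj, ih le_rfl]

theorem prod_map_enterMatrix_of_mem_languageANBNCN (R : Type*) [CommRing R] {w : List (Fin 3)}
    (hw : w ∈ languageANBNCN (0 : Fin 3) 1 2) (hne : w ≠ []) :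
    (w.map (enterMatrix R)).prod 0 2 = 1 := by
  obtain ⟨n, rfl⟩ := hw
  cases n with
  | zero => exact absurd rfl hne
  | succ n =>
    rw [List.append_assoc, prod_map_enterMatrix_replicate_append le_rfl,
      prod_map_enterMatrix_replicate_append (Fin.zero_le 1),
      ← List.append_nil (List.replicate (n + 1) (2 : Fin 3)),
      prod_map_enterMatrix_replicate_append (by decide)]
    rfl

theorem map_mem_languageANBNCN_iff {S T : Type*} {x : S → T} (hx : Function.Injective x)
    {a b c : S} {w : List S} :
    w.map x ∈ languageANBNCN (x a) (x b) (x c) ↔ w ∈ languageANBNCN a b c := by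
  refine exists_congr fun n => ?_
  rw [← List.map_replicate, ← List.map_replicate, ← List.map_replicate, ← List.map_append,
    ← List.map_append, (List.map_injective_iff.mpr hx).eq_iff]

theorem mem_languageANBNCN_and_wordContent_eq_iff {w : List (Fin 3)} {m : Fin 3 →₀ ℕ} :
    w ∈ languageANBNCN (0 : Fin 3) 1 2 ∧ wordContent w = m ↔
      (m 0 = m 1 ∧ m 1 = m 2) ∧
        w = List.replicate (m 0) 0 ++ List.replicate (m 0) 1 ++ List.replicate (m 0) 2 := by
  have hcontent : ∀ (n : ℕ) (i : Fin 3), wordContent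
      (List.replicate n 0 ++ List.replicate n 1 ++ List.replicate n (2 : Fin 3)) i = n := by
    intro n i
    fin_cases i <;> simp [wordContent, List.count_replicate]
  constructor
  · rintro ⟨⟨n, rfl⟩, rfl⟩
    simp only [hcontent, and_self]
  · rintro ⟨⟨h01, h12⟩, rfl⟩
    refine ⟨⟨m 0, rfl⟩, Finsupp.ext fun i => (hcontent _ i).trans ?_⟩
    fin_cases i
    exacts [rfl, h01, h01.trans h12]

open Classical in
/-- The entry `(0, 2)` does not see the empty word, whence the summand `1`. -/
theorem one_add_sortedMatrix_eq_diagonalSeries {T : Type*} (k : Type*) [CommRing k]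
    {x : Fin 3 → T} (hx : Function.Injective x) :
    1 + sortedMatrix x (fun w => if w ∈ languageANBNCN (x 0) (x 1) (x 2) then (1 : k) else 0) 0 2 =
      diagonalSeries k := by
  ext m
  rw [map_add, sortedMatrix, coeff_transferMatrix, coeff_diagonalSeries, MvPowerSeries.coeff_one]
  simp only [map_mem_languageANBNCN_iff hx]
  rcases eq_or_ne m 0 with rfl | hm
  · simp [wordsWithContent_zero]
  have hprod : ∀ w ∈ wordsWithContent m, w ∈ languageANBNCN (0 : Fin 3) 1 2 →
      (w.map (enterMatrix k)).prod 0 2 = 1 := fun w hw hwL =>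
    prod_map_enterMatrix_of_mem_languageANBNCN k hwL fun h => hm <| by
      rw [← mem_wordsWithContent.mp hw, h]
      rfl
  rw [if_neg hm, zero_add]
  simp only [ite_mul, one_mul, zero_mul]
  rw [← Finset.sum_filter, Finset.sum_congr rfl fun w hw =>
    hprod w (Finset.mem_filter.mp hw).1 (Finset.mem_filter.mp hw).2]
  have hfilter : ∀ w, w ∈ (wordsWithContent m).filter (· ∈ languageANBNCN (0 : Fin 3) 1 2) ↔
      (m 0 = m 1 ∧ m 1 = m 2) ∧
        w = List.replicate (m 0) 0 ++ List.replicate (m 0) 1 ++ List.replicate (m 0) 2 :=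
    fun w => by
      rw [Finset.mem_filter, mem_wordsWithContent, and_comm,
        mem_languageANBNCN_and_wordContent_eq_iff]
  split_ifs with hdiag
  · rw [Finset.eq_singleton_iff_unique_mem.mpr ⟨(hfilter _).mpr ⟨hdiag, rfl⟩,
      fun w hw => ((hfilter w).mp hw).2⟩, Finset.sum_singleton]
  · rw [Finset.eq_empty_of_forall_notMem fun w hw => hdiag ((hfilter w).mp hw).1, Finset.sum_empty]

end EqualPowers

section Grammars

open Classical in
theorem exists_natCast_ncard_parseTrees_ne {T : Type*} (k : Type*) [Field k] {x : Fin 3 → T}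
    (hx : Function.Injective x) (g : ContextFreeGrammar T)
    (hg : ∀ w, (g.parseTrees w).Finite) :
    ∃ w, ((g.parseTrees w).ncard : k) ≠
      if w ∈ languageANBNCN (x 0) (x 1) (x 2) then 1 else 0 := by
  by_contra! h
  have hne : (g.parseTrees []).ncard ≠ 0 := fun h0 => by
    have hnil := h []
    rw [if_pos ⟨0, rfl⟩, h0, Nat.cast_zero] at hnil
    exact zero_ne_one hnil
  have hinitial : g.initial ∈ ParseForest.finitaryNonterminals g :=
    ⟨hg, ⟨(Set.nonempty_of_ncard_ne_zero hne).some⟩⟩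
  have hmem := (ParseForest.regularSystem g k).sortedMatrix_symbolSeries_mem x 0 2
    (.nonterminal ⟨g.initial, hinitial⟩)
  have hseries : symbolSeries (ParseForest.regularSystem g k).series
      (.nonterminal ⟨g.initial, hinitial⟩) = _ := funext h
  rw [hseries] at hmem
  refine diagonalSeries_notMem_separatedAlgebraic (k := k) ?_
  rw [← one_add_sortedMatrix_eq_diagonalSeries k hx]
  exact add_mem (one_mem _) hmem

open Classical in
theorem theorem4p3_general {T : Type*} (k : Type*) [Field k] {a b c : T} (hab : a ≠ b)
    (hac : a ≠ c) (hbc : b ≠ c) :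
    (¬ ∃ g : ContextFreeGrammar T, (∀ w, (g.parseTrees w).Finite) ∧
      ∀ w, ((g.parseTrees w).ncard : k) = if w ∈ languageANBNCN a b c then 1 else 0) ∧
    (algebraMap (MvPowerSeries (Fin 3) k) (FractionRing (MvPowerSeries (Fin 3) k))
      (1 - MvPowerSeries.X 0 * MvPowerSeries.X 1 * MvPowerSeries.X 2))⁻¹ ∉
        separatedFractions (Fin 3) k := by
  refine ⟨fun ⟨g, hg, h⟩ => ?_, inv_one_sub_notMem_separatedFractions⟩
  have hx : Function.Injective ![a, b, c] := by
    intro i j h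
    fin_cases i <;> fin_cases j <;> simp_all
  obtain ⟨w, hw⟩ := exists_natCast_ncard_parseTrees_ne k hx g hg
  exact hw (h w)

theorem algebraicSeriesIn_subset_separatedSeries (i : Fin 3) :
    algebraicSeriesIn i ⊆ separatedSeries (Fin 3) (ZMod 2) := by
  rintro _ ⟨g, -, rfl⟩
  exact le_iSup (fun i => (PowerSeries.toMvPowerSeries (R := ZMod 2) i).range) i ⟨g, rfl⟩

theorem Rabc_subset_separatedFractions : Rabc ⊆ separatedFractions (Fin 3) (ZMod 2) := by
  rintro _ ⟨n, A, B, C, p, q, r, hA, hB, hC, hp, hq, hr, hp0, hq0, hr0, rfl⟩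
  exact ⟨∑ i, A i * B i * C i, sum_mem fun i _ =>
      mul_mem (mul_mem (algebraicSeriesIn_subset_separatedSeries 0 (hA i))
        (algebraicSeriesIn_subset_separatedSeries 1 (hB i)))
        (algebraicSeriesIn_subset_separatedSeries 2 (hC i)),
    p * q * r, mul_mem (mul_mem (mem_bivariateProducts hp0 hp) (mem_bivariateProducts hq0 hq))
      (mem_bivariateProducts hr0 hr), rfl⟩

open Classical in
theorem natCast_eq_ite_odd (n : ℕ) : (n : ZMod 2) = if Odd n then 1 else 0 := by
  split_ifs with h
  · exact (ZMod.natCast_eq_one_iff_odd).mpr h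
  · exact (ZMod.natCast_eq_zero_iff_even).mpr (Nat.not_odd_iff_even.mp h)

theorem one_add_eq_one_sub (f : MvPowerSeries (Fin 3) (ZMod 2)) : 1 + f = 1 - f := by
  ext m
  rw [map_add, map_sub, CharTwo.sub_eq_add]

end Grammars

theorem theorem4p3 {T : Type*} (a b c : T) (hab : a ≠ b) (hac : a ≠ c) (hbc : b ≠ c) :
    (¬ ∃ G : GF2Grammar T, G.language = languageANBNCN a b c) ∧
    (algebraMap (MvPowerSeries (Fin 3) (ZMod 2)) (FractionRing (MvPowerSeries (Fin 3) (ZMod 2)))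
      (1 + MvPowerSeries.X 0 * MvPowerSeries.X 1 * MvPowerSeries.X 2))⁻¹ ∉ Rabc := by
  classical
  obtain ⟨hgrammar, hinv⟩ := theorem4p3_general (ZMod 2) hab hac hbc
  refine ⟨fun ⟨G, hG⟩ => hgrammar ⟨G.ordinary, G.finite_parseTrees, fun w => ?_⟩, fun h => hinv ?_⟩
  · exact (natCast_eq_ite_odd _).trans (if_congr (Set.ext_iff.mp hG w) rfl rfl)
  · exact one_add_eq_one_sub (MvPowerSeries.X 0 * _ * _) ▸ Rabc_subset_separatedFractions h
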